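/- Let $P$ be a rooted forest, i.e. a poset that is a disjoint union of trees, each rooted at a unique bottom element (equivalently, for every $x\in P$ the set $\{y\in P: y\le x\}$ is a finite chain). Let $P_0$ be $P$ with a bottom element $0$ adjoined, so that a letter $b \in P$ has rank $2$ in $P_0$ if and only if it covers a minimal element of $P$. Let $P^*$ be the set of finite words over $P$ (including the empty word), with the generalized subword order: $u\le w$ if $w$ has a subword $w(i_1)\cdots w(i_k)$ of the same length $k$ as $u$ with $u(j)\le_P w(i_j)$ for all $j$. An interval $[x,y]$ of a poset is called disconnected, or shellable, if the order complex of the open interval $(x,y)$ is. The rank of $[x,y]$ is one less than the maximal number of elements in a chain in $[x,y]$. A disconnected interval is non-trivial if its rank is at least $3$. A finite interval $[b,t]$ of a poset all of whose maximal chains have the same length is CL-shellable if it has a CL-labeling: an assignment of labels, from some poset, to the edges of each maximal chain of $[b,t]$ (read from bottom to top), such that maximal chains which coincide along their first $d$ edges have the same labels on these edges, and such that for all $b\le x\le y\le t$ and every maximal chain $r$ of $[b,x]$ (the root), exactly one maximal chain of $[x,y]$ has weakly increasing labels with respect to $r$, and its label sequence is lexicographically strictly smaller than those of all other maximal chains of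 $[x,y]$ with respect to $r$. An interval is dual CL-shellable, or has a dual CL-labeling, if its dual is CL-shellable, or has a CL-labeling; chains are then read from top to bottom. Modified position labeling of $[u,w]$ in $P^*$: follow a maximal chain from $w$ down to $u$. In each covering step $v'\to v$ one letter of $v'$ is either decreased to the letter of $P$ that it covers, or (if it is a minimal element of $P$) deleted; if a letter from a maximal sequence of consecutive equal minimal letters is deleted, the leftmost one of that sequence is taken to be the deleted one. Thus each remaining letter keeps the position in $w$, counted from $1$, from which it originates, and the step $v'\to v$ is labeled by the position $k$ in $w$ of the decreased or deleted letter. The only exception: if $v''\to v'\to v$ are consecutive in the chain, the step $v''\to v'$ decreases a letter $b$ of rank $2$ in $P_0$ which is not the first in its maximal sequence of consecutive letters $b$ in $v''$, and the step $v'\to v$ deletes the resulting minimal letter, then $v'\to v$ is labeled by $k-\tfrac12$ instead of $k$. **Theorem.** Let $P$ be a rooted forest and let $u\le w$ in $P^*$ be such that $[u,w]$ contains no non-trivial disconnected subinterval. Then the modified position labeling is a dual CL-labeling of $[u,w]$; in particular, $[u,w]$ is dual CL-shellable, and hence shellable. Consequently, if $\sigma\le\tau$ are layered permutations (i.e. the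 letters of each component of the finest direct sum decomposition are decreasing) such that the interval $[\sigma,\tau]$ in the poset of all permutations ordered by pattern containment contains no non-trivial disconnected subinterval, then $[\sigma,\tau]$ is shellable. -/

import Mathlib

/-! ### Order complexes, connectedness and shellability of intervals of a poset -/

namespace SubwordShelling

section Posets

universe u

variable {Q : Type u}

/-- The order complex of a subset `S` of a poset: the faces are the finite chains of elements
of `S` (the empty chain included). -/
def orderComplex [PartialOrder Q] (S : Set Q) : Set (Finset Q) :=
  {F | (F : Set Q) ⊆ S ∧ IsChain (· ≤ ·) (F : Set Q)}

/-- The closed interval `[x, y]` is disconnected: the order complex of the open interval `(x, y)`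
is the disjoint union of two subcomplexes with nonempty vertex sets `A` and `B`. -/
def IsDisconnectedInterval [PartialOrder Q] (x y : Q) : Prop :=
  ∃ A B : Set Q, A.Nonempty ∧ B.Nonempty ∧ Disjoint A B ∧ A ∪ B = Set.Ioo x y ∧
    ∀ F ∈ orderComplex (Set.Ioo x y), (F : Set Q) ⊆ A ∨ (F : Set Q) ⊆ B

/-- `[u, w]` contains a non-trivial disconnected subinterval, that is, a disconnected subinterval
`[x, y]` of rank at least `3`. The rank of `[x, y]` is one less than the maximal number of
elements of a chain in `[x, y]`. -/
def HasNontrivialDisconnectedSubinterval [PartialOrder Q] (u w : Q) : Prop :=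
  ∃ x y : Q, u ≤ x ∧ x ≤ y ∧ y ≤ w ∧ 3 ≤ Order.krullDim (Set.Icc x y) ∧
    IsDisconnectedInterval x y

/-- The facets of a simplicial complex, given by its set of faces. -/
def IsFacet (K : Set (Finset Q)) (F : Finset Q) : Prop :=
  Maximal (· ∈ K) F

/-- Shellability of a complex with finitely many facets: it is pure, and its facets can be listed
as `F₀, F₁, …` such that, for every `k ≥ 1`, the intersection of the subcomplex generated by
`F₀, …, F_{k-1}` with the simplex `F_k` is pure of dimension `dim F_k - 1`. -/
def IsShellableComplex (K : Set (Finset Q)) : Prop :=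
  (∀ F G, IsFacet K F → IsFacet K G → F.card = G.card) ∧
  ∃ L : List (Finset Q), L.Nodup ∧ (∀ F, F ∈ L ↔ IsFacet K F) ∧
    ∀ (k : ℕ) (hk : k < L.length) (i : ℕ) (hi : i < k) (G : Finset Q), G ⊆ L[i] → G ⊆ L[k] →
      ∃ (j : ℕ) (hj : j < k) (H : Finset Q), H ⊆ L[j] ∧ H ⊆ L[k] ∧ G ⊆ H ∧
        H.card + 1 = L[k].card

/-- The interval `[x, y]` is shellable: the order complex of the open interval `(x, y)` is. -/
def IsShellableInterval [PartialOrder Q] (x y : Q) : Prop :=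
  IsShellableComplex (orderComplex (Set.Ioo x y))

/-! ### CL-shellability -/

/-- The list `c` is a saturated chain `x = c₀ ⋖ c₁ ⋖ ⋯ ⋖ c_m = y`; equivalently, a maximal chain
of the interval `[x, y]`, listed from bottom to top. -/
def IsSaturatedChain [PartialOrder Q] (x y : Q) (c : List Q) : Prop :=
  c.IsChain (· ⋖ ·) ∧ c.head? = some x ∧ c.getLast? = some y

/-- A chain-edge labeling assigns labels to the edges of every maximal chain of `[b, t]`, in such a
way that maximal chains which coincide along their first `d` edges have the same labels there.
So the label of an edge is determined by the saturated chain that starts at `b` and ends with that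
edge, and a chain-edge labeling is given by a function `lab` whose value at
`[b = c₀, c₁, …, c_m]`, `m ≥ 1`, is the label of the edge `c_{m-1} ⋖ c_m` (in every maximal chain
of which this is an initial segment).

If `r` is a saturated chain from `b` to `x` (the root) and `x ⋖ y₁ ⋖ ⋯ ⋖ y_m`, then
`rootedLabels lab r [y₁, …, y_m]` is the sequence of the labels of the edges of the chain
`x ⋖ y₁ ⋖ ⋯ ⋖ y_m` relative to the root `r`. -/
def rootedLabels {Λ : Type*} (lab : List Q → Λ) : List Q → List Q → List Λ
  | _, [] => []
  | r, y :: c => lab (r ++ [y]) :: rootedLabels lab (r ++ [y]) c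

/-- `lab` is a CL-labeling of `[b, t]`: every rooted interval `[x, y]_r` has a unique maximal chain
with weakly increasing labels, and the label sequence of this chain is lexicographically strictly
smaller than that of any other maximal chain of `[x, y]_r`. -/
def IsCLLabeling [PartialOrder Q] {Λ : Type*} [PartialOrder Λ] (b t : Q) (lab : List Q → Λ) :
    Prop :=
  ∀ (x y : Q) (r : List Q), IsSaturatedChain b x r → x ≤ y → y ≤ t →
    ∃ c : List Q, IsSaturatedChain x y c ∧ (rootedLabels lab r c.tail).IsChain (· ≤ ·) ∧
      ∀ c' : List Q, IsSaturatedChain x y c' → c' ≠ c →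
        ¬ (rootedLabels lab r c'.tail).IsChain (· ≤ ·) ∧
        List.Lex (· < ·) (rootedLabels lab r c.tail) (rootedLabels lab r c'.tail)

/-- `[b, t]` is CL-shellable: it is finite and graded (all its maximal chains have the same
length), and it has a CL-labeling with labels in some poset. -/
def IsCLShellable [PartialOrder Q] (b t : Q) : Prop :=
  (Set.Icc b t).Finite ∧
  (∀ c c' : List Q, IsSaturatedChain b t c → IsSaturatedChain b t c' → c.length = c'.length) ∧
  ∃ (Λ : Type) (_ : PartialOrder Λ) (lab : List Q → Λ), IsCLLabeling b t lab

/-- The dual of the interval `[u, w]` has the CL-labeling `lab`. The argument of `lab` is a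
saturated chain from the top element `w` downwards, listed from top to bottom. -/
def IsDualCLLabeling [PartialOrder Q] {Λ : Type*} [PartialOrder Λ] (u w : Q) (lab : List Q → Λ) :
    Prop :=
  IsCLLabeling (OrderDual.toDual w) (OrderDual.toDual u) (fun c => lab (c.map OrderDual.ofDual))

/-- `[u, w]` is dual CL-shellable: its dual is CL-shellable. -/
def IsDualCLShellable [PartialOrder Q] (u w : Q) : Prop :=
  IsCLShellable (OrderDual.toDual w) (OrderDual.toDual u)

end Posets

/-! ### Generalized subword order -/

section Words

universe u

/-- A rooted forest: a poset in which the elements below any given element form a finite chain.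
That is, the poset is a disjoint union of trees, each with a root as its bottom element. -/
def IsRootedForest (P : Type u) [PartialOrder P] : Prop :=
  ∀ x : P, (Set.Iic x).Finite ∧ IsChain (· ≤ ·) (Set.Iic x)

/-- The set `P*` of finite words in the alphabet `P`. -/
@[ext]
structure Word (P : Type u) where
  letters : List P

variable {P : Type u} [PartialOrder P]

/-- Generalized subword order: `u ≤ w` if `w` has a subword `l` of the same length as `u` with
`u(j) ≤ l(j)` in `P` for all `j`. -/
instance : LE (Word P) :=
  ⟨fun u w => ∃ l : List P, l.Sublist w.letters ∧ List.Forall₂ (· ≤ ·) u.letters l⟩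

theorem Word.le_iff (u w : Word P) :
    u ≤ w ↔ List.SublistForall₂ (· ≤ ·) u.letters w.letters := by
  rw [List.sublistForall₂_iff]
  exact ⟨fun ⟨l, h1, h2⟩ => ⟨l, h2, h1⟩, fun ⟨l, h1, h2⟩ => ⟨l, h2, h1⟩⟩

theorem forall₂_le_antisymm : ∀ (l m : List P), List.Forall₂ (· ≤ ·) l m →
    List.Forall₂ (· ≤ ·) m l → l = m
  | [], [], _, _ => rfl
  | a :: l, b :: m, h, h' => by
    rw [List.forall₂_cons] at h h'
    rw [le_antisymm h.1 h'.1, forall₂_le_antisymm l m h.2 h'.2]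
  | [], _ :: _, h, _ => by cases h
  | _ :: _, [], h, _ => by cases h

instance : PartialOrder (Word P) where
  le := (· ≤ ·)
  le_refl u := ⟨u.letters, List.Sublist.refl _, List.forall₂_refl _⟩
  le_trans a b c h h' := by
    rw [Word.le_iff] at *
    exact _root_.trans h h'
  le_antisymm a b := by
    rintro ⟨l, hl, hal⟩ ⟨m, hm, hbm⟩
    have h1 := hl.length_le
    have h2 := hal.length_eq
    have h3 := hm.length_le
    have h4 := hbm.length_eq
    have h5 : l = b.letters := hl.eq_of_length (by omega)
    have h6 : m = a.letters := hm.eq_of_length (by omega)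
    subst h5 h6
    exact Word.ext (forall₂_le_antisymm _ _ hal hbm)

end Words

/-! ### The modified position labeling

A saturated chain from `w` downwards is read as a sequence of embeddings in `w`. For an element `v`
of the chain, the embedding of `v` in `w` is recorded by the list of the positions of `w`
(counted from `1`) at which its letters stand; the letters at all other positions have been
deleted. -/

section Labeling

universe u

variable {P : Type u}

open Classical in
/-- For a covering relation `v' → v`, the index (counted from `0`) of the letter of `v'` that is
decreased or deleted in going to `v`. If `v` and `v'` have the same number of letters, then it is
the index where they differ. Otherwise a letter of `v'` is deleted and, among the letters whose
deletion gives `v` (these form a maximal sequence of consecutive equal letters), the leftmost is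
chosen. -/
noncomputable def stepIndex (v' v : Word P) : ℕ :=
  if v.letters.length = v'.letters.length then
    sInf {j | v'.letters[j]? ≠ v.letters[j]?}
  else
    sInf {j | j < v'.letters.length ∧ v'.letters.eraseIdx j = v.letters}

/-- The positions in `w` of the letters of `v`, if `v' → v` is a covering relation and the letters
of `v'` stand at the positions `pos`. -/
noncomputable def stepPositions (pos : List ℕ) (v' v : Word P) : List ℕ :=
  if v.letters.length = v'.letters.length then pos else pos.eraseIdx (stepIndex v' v)

/-- The condition, for consecutive elements `x → v' → v` of a chain, under which the label of
`v' → v` is modified: a letter `b` of rank `2` in `P₀` (that is, `P` with a bottom element adjoined)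
in `x` that is not the first in its maximal sequence of consecutive letters `b`, is decreased in
`x → v'`, and the resulting letter is deleted in `v' → v`. -/
def IsModifiedStep [PartialOrder P] (x v' v : Word P) : Prop :=
  v'.letters.length = x.letters.length ∧ v.letters.length < v'.letters.length ∧
  stepIndex v' v = stepIndex x v' ∧ 0 < stepIndex x v' ∧
  ∃ b : P, Order.height (b : WithBot P) = 2 ∧
    x.letters[stepIndex x v']? = some b ∧ x.letters[stepIndex x v' - 1]? = some b

open Classical in
/-- The label of the edge `v' → v` of a chain, where `pos` lists the positions in `w` of the
letters of `v'`, and `prev` is the element just above `v'` in the chain, if there is one. It is the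
position `k` in `w` that is decreased or deleted, replaced by `k - 1/2` in the modified case. -/
noncomputable def modifiedEdgeLabel [PartialOrder P] (prev : Option (Word P)) (pos : List ℕ)
    (v' v : Word P) : ℚ :=
  if ∃ x, prev = some x ∧ IsModifiedStep x v' v then
    (pos.getD (stepIndex v' v) 0 : ℚ) - 1 / 2
  else
    (pos.getD (stepIndex v' v) 0 : ℚ)

/-- The labels of the successive edges of a chain, listed from top to bottom, where `pos` lists the
positions in `w` of the letters of its first element, and `prev` is the element just above it,
if there is one. -/
noncomputable def modifiedEdgeLabels [PartialOrder P] :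
    Option (Word P) → List ℕ → List (Word P) → List ℚ
  | prev, pos, v' :: v :: c =>
    modifiedEdgeLabel prev pos v' v ::
      modifiedEdgeLabels (some v') (stepPositions pos v' v) (v :: c)
  | _, _, _ => []

/-- The modified position labeling, for the chains that start at `w` and are listed from top to
bottom: the label of the last edge of the chain `c`. -/
noncomputable def modifiedPositionLabeling [PartialOrder P] (w : Word P) (c : List (Word P)) : ℚ :=
  (modifiedEdgeLabels none (List.range' 1 w.letters.length) c).getLast?.getD 0

end Labeling

/-! ### Layered permutations -/

section Permutations

/-- A permutation of any length (with positions and letters counted from `0`). -/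
structure Permutation where
  length : ℕ
  toPerm : Equiv.Perm (Fin length)

/-- Pattern containment: `σ ≤ τ` if `τ` has a subsequence whose letters are in the same relative
order of size as those of `σ`. -/
instance : LE Permutation :=
  ⟨fun σ τ => ∃ f : Fin σ.length ↪o Fin τ.length, ∀ i j : Fin σ.length,
    σ.toPerm i < σ.toPerm j ↔ τ.toPerm (f i) < τ.toPerm (f j)⟩

instance : PartialOrder Permutation where
  le := (· ≤ ·)
  le_refl σ := ⟨RelEmbedding.refl _, fun _ _ => Iff.rfl⟩
  le_trans := by
    rintro a b c ⟨f, hf⟩ ⟨g, hg⟩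
    exact ⟨f.trans g, fun i j => (hf i j).trans (hg (f i) (f j))⟩
  le_antisymm := by
    rintro ⟨n, σ⟩ ⟨m, τ⟩ ⟨f, hf⟩ ⟨g, hg⟩
    have h1 : n ≤ m := by simpa using Fintype.card_le_of_injective f f.injective
    have h2 : m ≤ n := by simpa using Fintype.card_le_of_injective g g.injective
    obtain rfl : n = m := le_antisymm h1 h2
    have hid : ∀ i, f i = i := fun i => by
      have hbij : Function.Surjective f := Finite.surjective_of_injective f.injective
      have : RelIso.ofSurjective f hbij = OrderIso.refl (Fin n) := Subsingleton.elim _ _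
      exact congrArg (fun e : Fin n ≃o Fin n => e i) this
    have hlt : ∀ i j, σ i < σ j ↔ τ i < τ j := fun i j => by
      have := hf i j
      simp only [hid] at this
      exact this
    have hmono : StrictMono (fun i => τ (σ.symm i)) := fun i j hij => by
      have := hlt (σ.symm i) (σ.symm j)
      simp only [Equiv.apply_symm_apply] at this
      exact this.1 hij
    let e : Fin n ≃o Fin n := hmono.orderIsoOfSurjective _ (σ.symm.trans τ).surjective
    have he : e = OrderIso.refl (Fin n) := Subsingleton.elim _ _
    have hst : σ = τ := by
      ext1 i
      have := congrArg (fun e : Fin n ≃o Fin n => e (σ i)) he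
      change τ (σ.symm (σ i)) = σ i at this
      rw [Equiv.symm_apply_apply] at this
      exact this.symm
    rw [hst]

/-- `π` is the direct sum of a permutation of length `m` and another permutation: the first `m`
letters of `π` are the `m` smallest ones. -/
def Permutation.IsCut (π : Permutation) (m : ℕ) : Prop :=
  ∀ i : Fin π.length, (i : ℕ) < m → (π.toPerm i : ℕ) < m

/-- The positions `i` and `j ≥ i` belong to the same component of the finest decomposition of `π`
as a direct sum. -/
def Permutation.SameComponent (π : Permutation) (i j : Fin π.length) : Prop :=
  ¬ ∃ m : ℕ, π.IsCut m ∧ (i : ℕ) < m ∧ m ≤ (j : ℕ)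

/-- `π` is layered: the letters of each component of its finest decomposition are decreasing. -/
def Permutation.IsLayered (π : Permutation) : Prop :=
  ∀ i j : Fin π.length, i < j → π.SameComponent i j → π.toPerm j < π.toPerm i

end Permutations

end SubwordShelling

open SubwordShelling

/-!
The lower covers of a word `y` arise by reducing one of its letters, and in a rooted forest they are
determined by the index of this letter (the leftmost one of its run, if a minimal letter is
deleted). Distinct lower covers of `y` therefore have distinct labels, in the order of the indices.
So the modified position labeling is a CL-labeling as soon as two local statements hold for all
`x ≤ y` and every root ending at `y`, where only steps to words `≥ x` are considered:

* after the step from `y` of smallest label, no smaller label occurs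
  (`modifiedEdgeLabel_le_next`);
* after any other step from `y`, a smaller label can occur (`exists_modifiedEdgeLabel_lt`).

By induction on the rank of `y`, they show that the chain that always makes the step of smallest
label is increasing, and that it is the only increasing chain (`exists_increasing_chain`). The first
statement holds since reductions at different places commute. For the second one, let `y'` be
obtained by reducing the letter of index `j`, although a letter further to the left could have been
reduced. Comparing the embeddings of `x` in `y'` and in `y`, from left to right, one sees that a
letter to the left of `j` can still be reduced in `y'`, unless `y = αbbβ` with the second `b`
at `j`, and `x ≤ αbβ` (`Reduces.exists_lt_or_double`). In this exceptional case, `b` is not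
minimal, because a deletion takes the leftmost letter of a run; if `b` has rank `2`, then the
modification by `1/2` provides the smaller label; and if `b` has rank at least `3`, then
`[αbβ, αbbβ]` is a non-trivial disconnected subinterval
(`hasNontrivialDisconnectedSubinterval_of_double`): each element of the open interval either ends
with `bβ` or begins with `αb`, but not both, and this property is inherited by comparable elements.

A CL-labeling yields a shelling in the usual way: list the maximal chains lexicographically
(`isShellableInterval_of_isCLLabeling`).

The statement on permutations is the case of the forest `ℕ`. Recording the sizes of the layers, less
one, turns layered permutations into words over `ℕ`, and pattern containment into generalized
subword order (`layeredPerm_le_iff`). As everything below a layered permutation is layered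
(`Permutation.IsLayered.exists_layeredPerm_eq_of_le`), intervals correspond to intervals.
-/

namespace SubwordShelling

/-! ### Saturated chains -/

section SaturatedChains

variable {Q : Type*} [PartialOrder Q]

theorem IsSaturatedChain.exists_eq_cons {x y : Q} {c : List Q} (h : IsSaturatedChain x y c) :
    ∃ l, c = x :: l := by
  obtain ⟨-, h2, -⟩ := h
  cases c with
  | nil => simp at h2
  | cons a l => exact ⟨l, by simpa using h2⟩

theorem isSaturatedChain_singleton (x : Q) : IsSaturatedChain x x [x] := by
  simp [IsSaturatedChain]

theorem isSaturatedChain_cons_cons {x y a z : Q} {l : List Q} :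
    IsSaturatedChain x y (a :: z :: l) ↔ a = x ∧ x ⋖ z ∧ IsSaturatedChain z y (z :: l) := by
  simp only [IsSaturatedChain, List.isChain_cons_cons, List.head?_cons, List.getLast?_cons_cons,
    Option.some.injEq]
  constructor
  · rintro ⟨⟨h1, h2⟩, rfl, h4⟩
    exact ⟨rfl, h1, h2, trivial, h4⟩
  · rintro ⟨rfl, h1, h2, -, h4⟩
    exact ⟨⟨h1, h2⟩, rfl, h4⟩

theorem isSaturatedChain_singleton_iff {x y a : Q} :
    IsSaturatedChain x y [a] ↔ a = x ∧ x = y := by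
  simp only [IsSaturatedChain, List.isChain_singleton, List.head?_cons, List.getLast?_singleton,
    Option.some.injEq, true_and]
  constructor
  · rintro ⟨rfl, rfl⟩; exact ⟨rfl, rfl⟩
  · rintro ⟨rfl, rfl⟩; exact ⟨rfl, rfl⟩

/-- A saturated chain is cut at any of its elements into two saturated chains. -/
theorem isSaturatedChain_append_cons {x y z : Q} {p s : List Q} :
    IsSaturatedChain x y (p ++ z :: s) ↔
      IsSaturatedChain x z (p ++ [z]) ∧ IsSaturatedChain z y (z :: s) := by
  simp only [IsSaturatedChain]
  rw [List.isChain_split]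
  have h1 : (p ++ z :: s).head? = (p ++ [z]).head? := by cases p <;> simp
  have h2 : (p ++ z :: s).getLast? = (z :: s).getLast? := by
    rw [List.getLast?_append]; simp [List.getLast?_cons]
  rw [h1, h2]
  simp
  tauto

theorem IsSaturatedChain.append {x y z : Q} {p s : List Q} (hp : IsSaturatedChain x z p)
    (hs : IsSaturatedChain z y (z :: s)) : IsSaturatedChain x y (p ++ s) := by
  have h3 := hp.2.2
  rw [List.getLast?_eq_some_iff] at h3
  obtain ⟨p', rfl⟩ := h3
  rw [List.append_assoc]
  exact isSaturatedChain_append_cons.2 ⟨hp, hs⟩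

theorem IsSaturatedChain.pairwise_lt {x y : Q} {c : List Q} (h : IsSaturatedChain x y c) :
    c.Pairwise (· < ·) := by
  rw [← List.isChain_iff_pairwise]
  exact h.1.imp fun _ _ h => h.lt

theorem IsSaturatedChain.left_mem {x y : Q} {c : List Q} (h : IsSaturatedChain x y c) :
    x ∈ c :=
  List.mem_of_mem_head? h.2.1

theorem IsSaturatedChain.right_mem {x y : Q} {c : List Q} (h : IsSaturatedChain x y c) :
    y ∈ c :=
  List.mem_of_mem_getLast? h.2.2

theorem IsSaturatedChain.left_le_of_mem {x y q : Q} {c : List Q} (h : IsSaturatedChain x y c)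
    (hq : q ∈ c) : x ≤ q := by
  obtain ⟨l, rfl⟩ := h.exists_eq_cons
  rcases List.mem_cons.1 hq with rfl | hq
  · exact le_rfl
  · exact ((List.pairwise_cons.1 h.pairwise_lt).1 q hq).le

theorem IsSaturatedChain.le_right_of_mem {x y q : Q} {c : List Q} (h : IsSaturatedChain x y c)
    (hq : q ∈ c) : q ≤ y := by
  obtain ⟨c', rfl⟩ := List.getLast?_eq_some_iff.1 h.2.2
  rcases List.mem_append.1 hq with hq | hq
  · exact ((List.pairwise_append.1 h.pairwise_lt).2.2 q hq y (by simp)).le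
  · simp at hq; exact hq.le

theorem IsSaturatedChain.le {x y : Q} {c : List Q} (h : IsSaturatedChain x y c) : x ≤ y :=
  h.left_le_of_mem h.right_mem

theorem isSaturatedChain_self_iff {x : Q} {c : List Q} : IsSaturatedChain x x c ↔ c = [x] := by
  constructor
  · intro h
    obtain ⟨l, rfl⟩ := h.exists_eq_cons
    cases l with
    | nil => rfl
    | cons z l =>
      rw [isSaturatedChain_cons_cons] at h
      exact absurd (h.2.1.lt.trans_le h.2.2.le) (lt_irrefl _)
  · rintro rfl
    exact isSaturatedChain_singleton x

theorem IsSaturatedChain.isChain {x y : Q} {c : List Q} (h : IsSaturatedChain x y c) :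
    IsChain (· ≤ ·) {q | q ∈ c} := by
  intro a ha b hb hab
  have : Std.Symm fun a b : Q => a ≤ b ∨ b ≤ a := ⟨fun _ _ h => h.symm⟩
  have := h.pairwise_lt.imp (S := fun a b => a ≤ b ∨ b ≤ a) (fun h => Or.inl h.le)
  exact this.forall ha hb hab

/-- Two saturated chains with the same elements are equal. -/
theorem IsSaturatedChain.eq_of_mem_iff {x y x' y' : Q} {c c' : List Q}
    (h : IsSaturatedChain x y c) (h' : IsSaturatedChain x' y' c') (H : ∀ q, q ∈ c ↔ q ∈ c') :
    c = c' :=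
  h.pairwise_lt.eq_of_mem_iff h'.pairwise_lt (by simpa using H)

/-- An element of the interval that is comparable to all elements of a saturated chain belongs to
this chain: saturated chains are maximal. -/
theorem IsSaturatedChain.mem_of_comparable {x y q : Q} {c : List Q} (h : IsSaturatedChain x y c)
    (hx : x ≤ q) (hy : q ≤ y) (hc : ∀ a ∈ c, a ≤ q ∨ q ≤ a) : q ∈ c := by
  induction c generalizing x with
  | nil => simp [IsSaturatedChain] at h
  | cons a l ih =>
    cases l with
    | nil =>
      rw [isSaturatedChain_singleton_iff] at h
      obtain ⟨rfl, rfl⟩ := h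
      simp [le_antisymm hy hx]
    | cons z l =>
      rw [isSaturatedChain_cons_cons] at h
      obtain ⟨rfl, h1, h2⟩ := h
      rcases hc z (by simp) with h3 | h3
      · exact List.mem_cons_of_mem _ (ih h2 h3 fun b hb => hc b (List.mem_cons_of_mem _ hb))
      · rcases h1.eq_or_eq hx h3 with rfl | rfl <;> simp

/-- Every chain in a finite interval is contained in a saturated chain. -/
theorem exists_isSaturatedChain_superset {x y : Q} (hxy : x ≤ y) (hfin : (Set.Icc x y).Finite)
    (G : Set Q) (hG : G ⊆ Set.Icc x y) (hGc : IsChain (· ≤ ·) G) :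
    ∃ c, IsSaturatedChain x y c ∧ ∀ g ∈ G, g ∈ c := by
  induction hn : (Set.Icc x y).ncard using Nat.strong_induction_on generalizing x y G with
  | _ n ih =>
    subst hn
    rcases hxy.eq_or_lt with rfl | hlt
    · refine ⟨[x], isSaturatedChain_singleton x, fun g hg => ?_⟩
      have := hG hg
      simp at this
      simp [this]
    -- an element strictly between `x` and `y` that is comparable to all of `G` splits the problem
    have key : ∀ m, x < m → m < y → (∀ g ∈ G, g ≤ m ∨ m ≤ g) →
        ∃ c, IsSaturatedChain x y c ∧ ∀ g ∈ G, g ∈ c := by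
      intro m hxm hmy hm
      have s1 : Set.Icc x m ⊂ Set.Icc x y :=
        ⟨Set.Icc_subset_Icc_right hmy.le, fun h => (h ⟨hlt.le, le_rfl⟩).2.not_gt hmy⟩
      have s2 : Set.Icc m y ⊂ Set.Icc x y :=
        ⟨Set.Icc_subset_Icc_left hxm.le, fun h => (h ⟨le_rfl, hlt.le⟩).1.not_gt hxm⟩
      obtain ⟨c1, h1, h1'⟩ := ih _ (Set.ncard_lt_ncard s1 hfin) hxm.le (hfin.subset s1.1)
        (G ∩ Set.Iic m) (fun g hg => ⟨(hG hg.1).1, hg.2⟩) (hGc.mono Set.inter_subset_left) rfl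
      obtain ⟨c2, h2, h2'⟩ := ih _ (Set.ncard_lt_ncard s2 hfin) hmy.le (hfin.subset s2.1)
        (G ∩ Set.Ici m) (fun g hg => ⟨hg.2, (hG hg.1).2⟩) (hGc.mono Set.inter_subset_left) rfl
      obtain ⟨l, rfl⟩ := h2.exists_eq_cons
      refine ⟨c1 ++ l, h1.append h2, fun g hg => ?_⟩
      rcases hm g hg with h | h
      · exact List.mem_append_left _ (h1' g ⟨hg, h⟩)
      · rcases List.mem_cons.1 (h2' g ⟨hg, h⟩) with rfl | h
        · exact List.mem_append_left _ h1.right_mem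
        · exact List.mem_append_right _ h
    by_cases hex : ∃ g ∈ G, x < g ∧ g < y
    · obtain ⟨g, hg, h1, h2⟩ := hex
      exact key g h1 h2 fun g' hg' => hGc.total hg' hg
    · have hGxy : ∀ g ∈ G, g = x ∨ g = y := by
        intro g hg
        by_contra! hne
        exact hex ⟨g, hg, lt_of_le_of_ne (hG hg).1 hne.1.symm, lt_of_le_of_ne (hG hg).2 hne.2⟩
      by_cases hm : ∃ m, x < m ∧ m < y
      · obtain ⟨m, h1, h2⟩ := hm
        refine key m h1 h2 fun g hg => ?_
        rcases hGxy g hg with rfl | rfl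
        · exact Or.inl h1.le
        · exact Or.inr h2.le
      · refine ⟨[x, y], ?_, fun g hg => by simpa using hGxy g hg⟩
        rw [isSaturatedChain_cons_cons]
        exact ⟨rfl, ⟨hlt, fun m h1 h2 => hm ⟨m, h1, h2⟩⟩, isSaturatedChain_singleton y⟩

end SaturatedChains

/-! ### A CL-labeling yields a shelling -/

section Shelling

variable {Q : Type*}

theorem rootedLabels_append {Λ : Type*} (lab : List Q → Λ) (r p q : List Q) :
    rootedLabels lab r (p ++ q) = rootedLabels lab r p ++ rootedLabels lab (r ++ p) q := by
  induction p generalizing r with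
  | nil => simp [rootedLabels]
  | cons a p ih => simp [rootedLabels, ih]

theorem length_rootedLabels {Λ : Type*} (lab : List Q → Λ) (r p : List Q) :
    (rootedLabels lab r p).length = p.length := by
  induction p generalizing r with
  | nil => simp [rootedLabels]
  | cons a p ih => simp [rootedLabels, ih]

theorem lex_append_of_length_eq {Λ : Type*} {R : Λ → Λ → Prop} {l₁ l₂ : List Λ}
    (h : List.Lex R l₁ l₂) (hl : l₁.length = l₂.length) (m₁ m₂ : List Λ) :
    List.Lex R (l₁ ++ m₁) (l₂ ++ m₂) := by
  induction h with
  | nil => simp at hl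
  | rel h => exact List.Lex.rel h
  | cons _ ih => exact List.Lex.cons (ih (by simpa using hl))

theorem rootedLabels_isChain {Λ : Type*} [PartialOrder Λ] (lab : List Q → Λ) (r s : List Q) (g : Q)
    (h : ∀ s₁ m y s₂, s ++ [g] = s₁ ++ m :: y :: s₂ →
      lab (r ++ s₁ ++ [m]) ≤ lab (r ++ s₁ ++ [m, y])) :
    (rootedLabels lab r (s ++ [g])).IsChain (· ≤ ·) := by
  induction s generalizing r with
  | nil => simp [rootedLabels]
  | cons a s ih =>
    have h1 := ih (r ++ [a]) fun s₁ m y s₂ he => by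
      simpa using h (a :: s₁) m y s₂ (by simp [he])
    obtain ⟨b, l, hb⟩ : ∃ b l, s ++ [g] = b :: l := by cases s <;> simp
    have h2 := h [] a b l (by simp [← hb])
    rw [List.cons_append, rootedLabels]
    rw [hb, rootedLabels] at h1 ⊢
    exact List.isChain_cons_cons.2 ⟨by simpa using h2, h1⟩

/-- A nonempty list has a first element that lies in `G` or is the last one. -/
theorem exists_first_mem_or_last (G : Set Q) (p : List Q) (hp : p ≠ []) :
    ∃ s g p', p = s ++ g :: p' ∧ (∀ m ∈ s, m ∉ G) ∧ (g ∈ G ∨ p' = []) := by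
  induction p with
  | nil => exact absurd rfl hp
  | cons a p ih =>
    by_cases ha : a ∈ G
    · exact ⟨[], a, p, rfl, by simp, Or.inl ha⟩
    · by_cases hp : p = []
      · exact ⟨[], a, p, rfl, by simp, Or.inr hp⟩
      · obtain ⟨s, g, p', h1, h2, h3⟩ := ih hp
        exact ⟨a :: s, g, p', by simp [h1], by simpa [ha] using h2, h3⟩

variable [PartialOrder Q]

/-- The heart of the shelling: if a saturated chain `r ++ p` has weakly increasing labels at all
its interior elements outside `G`, then it is lexicographically smaller than every other saturated
chain that contains `G` and has the same root `r`. Indeed, cut it at the elements of `G`: each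
piece is the unique increasing chain of its rooted interval. -/
theorem eq_or_lex_of_ascents {Λ : Type*} [PartialOrder Λ] {b t : Q} {lab : List Q → Λ}
    (hlab : IsCLLabeling b t lab)
    (hgr : ∀ (x y : Q) (c c' : List Q), IsSaturatedChain x y c → IsSaturatedChain x y c' →
      c.length = c'.length)
    (G : Set Q) {x : Q} {r p q : List Q} (hr : IsSaturatedChain b x r)
    (hp : IsSaturatedChain x t (x :: p)) (hq : IsSaturatedChain x t (x :: q))
    (hG : ∀ g ∈ G, g ∈ r ∨ g ∈ q)
    (hasc : ∀ r' m y l, r ++ p = r' ++ m :: y :: l → r' ≠ [] → m ∉ G →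
      lab (r' ++ [m]) ≤ lab (r' ++ [m, y])) :
    p = q ∨ List.Lex (· < ·) (rootedLabels lab r p) (rootedLabels lab r q) := by
  induction hn : p.length using Nat.strong_induction_on generalizing x r p q with
  | _ n ih =>
    subst hn
    by_cases hp0 : p = []
    · subst hp0
      obtain rfl := (isSaturatedChain_singleton_iff.1 hp).2
      rw [isSaturatedChain_self_iff] at hq
      left
      simpa using hq.symm
    obtain ⟨s, g, p', rfl, hs, hg⟩ := exists_first_mem_or_last G p hp0
    have hp2 := isSaturatedChain_append_cons (p := x :: s) (z := g) (s := p') |>.1 (by simpa using hp)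
    have hxg : x < g := (List.pairwise_cons.1 hp.pairwise_lt).1 g (by simp)
    have hgt : g ≤ t := hp2.2.le
    have hgq : g ∈ q := by
      rcases hg with hg | rfl
      · refine (hG g hg).resolve_left fun h => ?_
        exact (hr.le_right_of_mem h).not_gt hxg
      · obtain rfl := (isSaturatedChain_singleton_iff.1 hp2.2).2
        exact (List.mem_cons.1 hq.right_mem).resolve_left hxg.ne'
    obtain ⟨s', q', rfl⟩ := List.append_of_mem hgq
    have hq2 := isSaturatedChain_append_cons (p := x :: s') (z := g) (s := q') |>.1
      (by simpa using hq)
    have hinc : (rootedLabels lab r (s ++ [g])).IsChain (· ≤ ·) := by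
      apply rootedLabels_isChain
      intro s₁ m y s₂ he
      have hm : m ∈ s := by
        rcases List.eq_nil_or_concat s₂ with rfl | ⟨s₂', z, rfl⟩
        · have he' : s ++ [g] = (s₁ ++ [m]) ++ [y] := by simp [he]
          rw [List.append_inj_left' he' rfl]; simp
        · have he' : s ++ [g] = (s₁ ++ m :: y :: s₂') ++ [z] := by simp [he]
          rw [List.append_inj_left' he' rfl]; simp
      have hr0 : r ≠ [] := by
        obtain ⟨l, rfl⟩ := hr.exists_eq_cons
        simp
      refine hasc (r ++ s₁) m y (s₂ ++ p') ?_ (by simp [hr0]) (hs m hm)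
      have : s ++ g :: p' = (s ++ [g]) ++ p' := by simp
      rw [this, he]; simp
    obtain ⟨c, hc1, hc2, hc3⟩ := hlab x g r hr hxg.le hgt
    have hcs : x :: s ++ [g] = c := by
      by_contra hne
      exact (hc3 _ hp2.1 hne).1 (by simpa using hinc)
    have e1 : ∀ (s p' : List Q), s ++ g :: p' = (s ++ [g]) ++ p' := by simp
    by_cases hss : s' = s
    · subst hss
      have hr' : IsSaturatedChain b g (r ++ (s' ++ [g])) := by
        have h := hp2.1
        rw [List.cons_append] at h
        exact hr.append h
      have := ih p'.length (by simp; omega) hr' hp2.2 hq2.2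
        (fun z hz => by
          rcases hG z hz with h | h
          · left; simp [h]
          · simp only [List.mem_append, List.mem_cons] at h ⊢
            tauto)
        (fun r' m y l he h0 hm => hasc r' m y l (by rw [← he]; simp) h0 hm) rfl
      rcases this with rfl | h
      · exact Or.inl rfl
      · right
        rw [e1 s' p', e1 s' q', rootedLabels_append lab r (s' ++ [g]) p',
          rootedLabels_append lab r (s' ++ [g]) q']
        exact List.Lex.append_left _ h _
    · right
      have hlex := (hc3 _ hq2.1 (by
        rw [← hcs]
        intro h
        exact hss (by simpa using h))).2
      rw [← hcs] at hlex
      rw [e1 s p', e1 s' q', rootedLabels_append lab r (s ++ [g]) p',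
          rootedLabels_append lab r (s' ++ [g]) q']
      refine lex_append_of_length_eq (by simpa using hlex) ?_ _ _
      rw [length_rootedLabels, length_rootedLabels]
      have := hgr x g _ _ hp2.1 hq2.1
      simpa using this

/-- A descent of a saturated chain at `m` can be repaired: replacing `m` by another element gives a
saturated chain that is lexicographically smaller. -/
theorem exists_lex_lt_of_descent {Λ : Type*} [PartialOrder Λ] {b t : Q} {lab : List Q → Λ}
    (hlab : IsCLLabeling b t lab)
    (hgr : ∀ (x y : Q) (c c' : List Q), IsSaturatedChain x y c → IsSaturatedChain x y c' →
      c.length = c'.length)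
    {r l : List Q} {m y : Q} (hr0 : r ≠ []) (hc : IsSaturatedChain b t (r ++ m :: y :: l))
    (hdesc : ¬ lab (r ++ [m]) ≤ lab (r ++ [m, y])) :
    ∃ m', IsSaturatedChain b t (r ++ m' :: y :: l) ∧
      List.Lex (· < ·) (rootedLabels lab [b] (r ++ m' :: y :: l).tail)
        (rootedLabels lab [b] (r ++ m :: y :: l).tail) := by
  obtain ⟨r', x, rfl⟩ := (List.eq_nil_or_concat r).resolve_left hr0
  rw [List.concat_eq_append] at *
  rw [List.append_assoc] at hc
  obtain ⟨h1, h2⟩ := isSaturatedChain_append_cons.1 hc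
  have h3 := isSaturatedChain_append_cons (p := [x, m]) (z := y) (s := l) |>.1 h2
  obtain ⟨c, hc1, hc2, hc3⟩ := hlab x y (r' ++ [x]) h1 h3.1.le h3.2.le
  have hne : [x, m, y] ≠ c := by
    rintro rfl
    simp [rootedLabels] at hc2 hdesc
    exact hdesc hc2
  have hlen : c.length = 3 := (hgr x y c _ hc1 h3.1).trans rfl
  obtain ⟨c', rfl⟩ := hc1.exists_eq_cons
  have h4 := hc1.2.2
  match c', hlen with
  | [m', y'], _ =>
    obtain rfl : y' = y := by simpa using h4
    refine ⟨m', ?_, ?_⟩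
    · rw [List.append_assoc]
      refine isSaturatedChain_append_cons.2 ⟨h1, ?_⟩
      exact isSaturatedChain_append_cons (p := [x, m']) (z := y') (s := l) |>.2 ⟨hc1, h3.2⟩
    · have hlex := (hc3 _ h3.1 hne).2
      obtain ⟨k, hk⟩ := h1.exists_eq_cons
      rw [hk] at hlex ⊢
      have e : ∀ m, (b :: k ++ m :: y' :: l).tail = k ++ [m, y'] ++ l := by simp
      rw [e, e, rootedLabels_append, rootedLabels_append lab [b] (k ++ [m, y']),
        rootedLabels_append lab [b] k, rootedLabels_append lab [b] k, List.append_assoc,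
        List.append_assoc]
      refine List.Lex.append_left _ ?_ _
      exact lex_append_of_length_eq (by simpa using hlex) (by simp [length_rootedLabels]) _ _

end Shelling

section Facets

variable {Q : Type*}

open Classical in
/-- The face of the order complex of the open interval `(x, y)` spanned by a list of elements. -/
noncomputable def openFace (x y : Q) (c : List Q) : Finset Q :=
  c.toFinset \ {x, y}

theorem mem_openFace {x y q : Q} {c : List Q} :
    q ∈ openFace x y c ↔ q ∈ c ∧ q ≠ x ∧ q ≠ y := by
  simp [openFace]

variable [PartialOrder Q]

theorem IsSaturatedChain.isFacet_openFace {x y : Q} {c : List Q} (h : IsSaturatedChain x y c) :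
    IsFacet (orderComplex (Set.Ioo x y)) (openFace x y c) := by
  refine ⟨⟨fun q hq => ?_, fun a ha a' ha' => ?_⟩, fun G hG hle g hg => ?_⟩
  · obtain ⟨h1, h2, h3⟩ := mem_openFace.1 hq
    exact ⟨lt_of_le_of_ne (h.left_le_of_mem h1) h2.symm,
      lt_of_le_of_ne (h.le_right_of_mem h1) h3⟩
  · exact h.isChain (mem_openFace.1 ha).1 (mem_openFace.1 ha').1
  · have hgm := hG.1 hg
    refine mem_openFace.2 ⟨h.mem_of_comparable hgm.1.le hgm.2.le fun a ha => ?_, hgm.1.ne', hgm.2.ne⟩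
    by_cases hax : a = x
    · subst hax; exact Or.inl hgm.1.le
    by_cases hay : a = y
    · subst hay; exact Or.inr hgm.2.le
    exact hG.2.total (hle (mem_openFace.2 ⟨ha, hax, hay⟩)) hg

/-- The facets of the order complex of an open interval are the saturated chains of the closed
interval, without their end points. -/
theorem isFacet_orderComplex_iff {x y : Q} (hxy : x ≤ y) (hfin : (Set.Icc x y).Finite)
    (F : Finset Q) :
    IsFacet (orderComplex (Set.Ioo x y)) F ↔ ∃ c, IsSaturatedChain x y c ∧ openFace x y c = F := by
  constructor
  · intro hF
    obtain ⟨c, hc, hFc⟩ := exists_isSaturatedChain_superset hxy hfin F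
      (hF.1.1.trans Set.Ioo_subset_Icc_self) hF.1.2
    refine ⟨c, hc, ?_⟩
    have hle : F ≤ openFace x y c := fun q hq =>
      mem_openFace.2 ⟨hFc q hq, (hF.1.1 hq).1.ne', (hF.1.1 hq).2.ne⟩
    exact le_antisymm (hF.2 hc.isFacet_openFace.1 hle) hle
  · rintro ⟨c, hc, rfl⟩
    exact hc.isFacet_openFace

theorem openFace_injOn (x y : Q) : Set.InjOn (openFace x y) {c | IsSaturatedChain x y c} := by
  intro c hc c' hc' h
  refine hc.eq_of_mem_iff hc' fun q => ?_
  have := Finset.ext_iff.1 h q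
  simp only [mem_openFace] at this
  by_cases hx : q = x
  · subst hx; exact iff_of_true hc.left_mem hc'.left_mem
  by_cases hy : q = y
  · subst hy; exact iff_of_true hc.right_mem hc'.right_mem
  simpa [hx, hy] using this

theorem IsSaturatedChain.card_openFace {x y : Q} {c : List Q} (h : IsSaturatedChain x y c) :
    (openFace x y c).card = c.length - (Finset.card (α := Q) (by classical exact {x, y})) := by
  classical
  have hsub : {x, y} ⊆ c.toFinset := by
    intro q
    simp only [Finset.mem_insert, Finset.mem_singleton, List.mem_toFinset]
    rintro (rfl | rfl)
    exacts [h.left_mem, h.right_mem]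
  have hcard := List.toFinset_card_of_nodup (h.pairwise_lt.imp (fun h => h.ne))
  rw [← hcard, ← Finset.card_sdiff_of_subset hsub]
  unfold openFace
  congr

/-- An interval that is finite and graded and has a CL-labeling is shellable: the maximal chains,
listed in lexicographic order of their label sequences, form a shelling. -/
theorem isShellableInterval_of_isCLLabeling {Λ : Type*} [LinearOrder Λ] {b t : Q}
    {lab : List Q → Λ} (hbt : b ≤ t) (hfin : (Set.Icc b t).Finite)
    (hgr : ∀ (x y : Q) (c c' : List Q), IsSaturatedChain x y c → IsSaturatedChain x y c' →
      c.length = c'.length)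
    (hlab : IsCLLabeling b t lab) : IsShellableInterval b t := by
  classical
  refine ⟨fun F G hF hG => ?_, ?_⟩
  · obtain ⟨c, hc, rfl⟩ := (isFacet_orderComplex_iff hbt hfin F).1 hF
    obtain ⟨c', hc', rfl⟩ := (isFacet_orderComplex_iff hbt hfin G).1 hG
    rw [hc.card_openFace, hc'.card_openFace, hgr b t c c' hc hc']
  have hCfin : {c : List Q | IsSaturatedChain b t c}.Finite := by
    refine Set.Finite.of_finite_image ?_ (openFace_injOn b t)
    refine (hfin.toFinset.powerset).finite_toSet.subset ?_
    rintro _ ⟨c, hc, rfl⟩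
    simp only [Finset.coe_powerset, Set.mem_preimage, Set.mem_powerset_iff]
    intro q hq
    have hq := (mem_openFace.1 hq).1
    simpa using ⟨IsSaturatedChain.left_le_of_mem hc hq, IsSaturatedChain.le_right_of_mem hc hq⟩
  let key : List Q → List Λ := fun c => rootedLabels lab [b] c.tail
  let rel : List Q → List Q → Prop := fun c c' => key c ≤ key c'
  have : Std.Total rel := ⟨fun c c' => le_total (key c) (key c')⟩
  have : IsTrans (List Q) rel := ⟨fun c c' c'' h h' => le_trans (α := List Λ) h h'⟩
  let L₀ : List (List Q) := hCfin.toFinset.toList.insertionSort rel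
  have hmem : ∀ c, c ∈ L₀ ↔ IsSaturatedChain b t c := fun c => by
    simp [L₀, List.mem_insertionSort]
  have hnodup : L₀.Nodup :=
    (List.perm_insertionSort rel _).nodup_iff.2 (Finset.nodup_toList _)
  have hsorted : L₀.Pairwise rel := List.pairwise_insertionSort rel _
  refine ⟨L₀.map (openFace b t), ?_, fun F => ?_, ?_⟩
  · refine hnodup.map_on fun c hc c' hc' h => ?_
    exact openFace_injOn b t ((hmem c).1 hc) ((hmem c').1 hc') h
  · rw [isFacet_orderComplex_iff hbt hfin, List.mem_map]
    simp only [hmem]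
  · intro k hk i hi G hGi hGk
    rw [List.length_map] at hk
    have hiL : i < L₀.length := hi.trans hk
    simp only [List.getElem_map] at hGi hGk ⊢
    have hck := (hmem _).1 (List.getElem_mem hk)
    have hci := (hmem _).1 (List.getElem_mem hiL)
    have hne : L₀[k] ≠ L₀[i] := fun h => by
      have := (hnodup.getElem_inj_iff).1 h
      omega
    have hle : key L₀[i] ≤ key L₀[k] := List.pairwise_iff_getElem.1 hsorted i k hiL hk hi
    -- the chain `L₀[k]` has a descent outside `G`, as otherwise it would come before `L₀[i]`
    obtain ⟨r, m, y, l, he, hr0, hmG, hdesc⟩ : ∃ r m y l, L₀[k] = r ++ m :: y :: l ∧ r ≠ [] ∧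
        m ∉ G ∧ ¬ lab (r ++ [m]) ≤ lab (r ++ [m, y]) := by
      by_contra! hcon
      obtain ⟨p, hp⟩ := hck.exists_eq_cons
      obtain ⟨q, hq⟩ := hci.exists_eq_cons
      have := eq_or_lex_of_ascents hlab hgr (G : Set Q) (isSaturatedChain_singleton b)
        (hp ▸ hck) (hq ▸ hci)
        (fun g hg => by
          right
          obtain ⟨h1, h2, h3⟩ := mem_openFace.1 (hGi hg)
          rw [hq] at h1
          exact (List.mem_cons.1 h1).resolve_left h2)
        (fun r' m y l h h0 hm => hcon r' m y l (by rw [hp]; exact h) h0 (by simpa using hm))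
      rcases this with h | h
      · exact hne (by rw [hp, hq, h])
      · refine absurd hle (not_le_of_gt ?_)
        simp only [key, hp, hq, List.tail_cons]
        exact h
    obtain ⟨m', hc', hlt⟩ := exists_lex_lt_of_descent hlab hgr hr0 (he ▸ hck) hdesc
    obtain ⟨j, hj, hjc⟩ := List.getElem_of_mem ((hmem _).2 hc')
    have hjk : j < k := by
      by_contra! hkj
      have h1 : key L₀[k] ≤ key L₀[j] := by
        rcases hkj.eq_or_lt with rfl | hkj
        · exact le_rfl
        · exact List.pairwise_iff_getElem.1 hsorted k j hk hj hkj
      refine absurd h1 (not_le_of_gt ?_)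
      simp only [key, hjc]
      rw [he]
      exact hlt
    have hpw := hck.pairwise_lt
    rw [he] at hpw
    have hmL : m ∈ openFace b t L₀[k] := by
      rw [mem_openFace]
      have h1 : m ∈ L₀[k] := by rw [he]; simp
      refine ⟨h1, ?_, ?_⟩
      · rintro rfl
        obtain ⟨r', x, rfl⟩ := (List.eq_nil_or_concat r).resolve_left hr0
        have h2 : x < m := (List.pairwise_append.1 hpw).2.2 x (by simp) m (by simp)
        exact (hck.left_le_of_mem (q := x) (by rw [he]; simp)).not_gt h2
      · rintro rfl
        have h2 : m < y :=
          (List.pairwise_cons.1 (List.pairwise_append.1 hpw).2.1).1 y (by simp)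
        exact (hck.le_right_of_mem (q := y) (by rw [he]; simp)).not_gt h2
    refine ⟨j, hjk, (openFace b t L₀[k]).erase m, ?_, Finset.erase_subset _ _, ?_, ?_⟩
    · intro q hq
      obtain ⟨h1, h2⟩ := Finset.mem_erase.1 hq
      rw [mem_openFace] at h2 ⊢
      refine ⟨?_, h2.2⟩
      have h3 := h2.1
      rw [he] at h3
      rw [hjc]
      simp only [List.mem_append, List.mem_cons] at h3 ⊢
      tauto
    · intro q hq
      exact Finset.mem_erase.2 ⟨fun h => hmG (h ▸ hq), hGk hq⟩
    · exact Finset.card_erase_add_one hmL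

end Facets

/-! ### Transfer of the complexes along maps of posets -/

section Transfer

theorem isFacet_image_map {Q Q' : Type*} (f : Q ↪ Q') (K : Set (Finset Q)) (F' : Finset Q') :
    IsFacet (Finset.map f '' K) F' ↔ ∃ F, IsFacet K F ∧ F.map f = F' := by
  constructor
  · rintro ⟨⟨F, hF, rfl⟩, hmax⟩
    refine ⟨F, ⟨hF, fun G hG hFG => ?_⟩, rfl⟩
    have := hmax ⟨G, hG, rfl⟩ (Finset.map_subset_map.2 hFG)
    exact Finset.map_subset_map.1 this
  · rintro ⟨F, hF, rfl⟩
    refine ⟨⟨F, hF.1, rfl⟩, ?_⟩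
    rintro _ ⟨G, hG, rfl⟩ hFG
    exact Finset.map_subset_map.2 (hF.2 hG (Finset.map_subset_map.1 hFG))

theorem IsShellableComplex.image_map {Q Q' : Type*} (f : Q ↪ Q') {K : Set (Finset Q)}
    (h : IsShellableComplex K) : IsShellableComplex (Finset.map f '' K) := by
  classical
  obtain ⟨hpure, L, h1, h2, h3⟩ := h
  refine ⟨?_, L.map (Finset.map f), h1.map (Finset.map_injective f), fun F => ?_, ?_⟩
  · intro F G hF hG
    obtain ⟨F, hF', rfl⟩ := (isFacet_image_map f K F).1 hF
    obtain ⟨G, hG', rfl⟩ := (isFacet_image_map f K G).1 hG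
    simpa using hpure F G hF' hG'
  · rw [isFacet_image_map, List.mem_map]
    simp only [h2]
  · intro k hk i hi G hGi hGk
    rw [List.length_map] at hk
    simp only [List.getElem_map] at hGi hGk ⊢
    obtain ⟨G, hG, rfl⟩ := Finset.subset_map_iff.1 hGi
    obtain ⟨j, hj, H, a1, a2, a3, a4⟩ := h3 k hk i hi G hG (Finset.map_subset_map.1 hGk)
    exact ⟨j, hj, H.map f, Finset.map_subset_map.2 a1, Finset.map_subset_map.2 a2,
      Finset.map_subset_map.2 a3, by simpa using a4⟩

theorem IsShellableInterval.of_dual {Q : Type*} [PartialOrder Q] {x y : Q}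
    (h : IsShellableInterval (OrderDual.toDual y) (OrderDual.toDual x)) :
    IsShellableInterval x y := by
  have : (orderComplex (Set.Ioo x y) : Set (Finset Q)) =
      (orderComplex (Set.Ioo (OrderDual.toDual y) (OrderDual.toDual x)) : Set (Finset Qᵒᵈ)) := by
    ext F
    refine and_congr ⟨fun h q hq => (h hq).symm, fun h q hq => (h hq).symm⟩ ?_
    exact ⟨fun h => h.symm, fun h => h.symm⟩
  unfold IsShellableInterval
  rw [this]
  exact h

variable {Q Q' : Type*} [PartialOrder Q] [PartialOrder Q']

/-- An order embedding whose range contains all elements below `f y` identifies the open interval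
`(x, y)` with `(f x, f y)`. -/
theorem image_Ioo_of_range (f : Q ↪o Q') {x y : Q} (hf : Set.Iic (f y) ⊆ Set.range f) :
    f '' Set.Ioo x y = Set.Ioo (f x) (f y) := by
  ext q
  constructor
  · rintro ⟨q, hq, rfl⟩
    exact ⟨f.lt_iff_lt.2 hq.1, f.lt_iff_lt.2 hq.2⟩
  · intro hq
    obtain ⟨q, rfl⟩ := hf hq.2.le
    exact ⟨q, ⟨f.lt_iff_lt.1 hq.1, f.lt_iff_lt.1 hq.2⟩, rfl⟩

theorem orderComplex_image (f : Q ↪o Q') (S : Set Q) :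
    orderComplex (f '' S) = Finset.map f.toEmbedding '' orderComplex S := by
  classical
  ext F
  constructor
  · rintro ⟨h1, h2⟩
    obtain ⟨G, hG, rfl⟩ := Finset.subset_set_image_iff.1 h1
    refine ⟨G, ⟨hG, fun a ha b hb hab => ?_⟩, by rw [Finset.map_eq_image]; rfl⟩
    have := h2 (Finset.mem_coe.2 (Finset.mem_image_of_mem f ha))
      (Finset.mem_coe.2 (Finset.mem_image_of_mem f hb)) (f.injective.ne hab)
    simpa using this
  · rintro ⟨F, ⟨h1, h2⟩, rfl⟩
    rw [orderComplex, Set.mem_ofPred_eq, Finset.coe_map]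
    refine ⟨Set.image_mono h1, ?_⟩
    rintro _ ⟨a, ha, rfl⟩ _ ⟨b, hb, rfl⟩ hab
    simpa using h2 ha hb (fun h => hab (by rw [h]))

theorem IsShellableInterval.map (f : Q ↪o Q') {x y : Q} (hf : Set.Iic (f y) ⊆ Set.range f)
    (h : IsShellableInterval x y) : IsShellableInterval (f x) (f y) := by
  unfold IsShellableInterval
  rw [← image_Ioo_of_range f hf, orderComplex_image]
  exact IsShellableComplex.image_map _ h

theorem HasNontrivialDisconnectedSubinterval.map (f : Q ↪o Q') {u w : Q}
    (hf : Set.Iic (f w) ⊆ Set.range f) (h : HasNontrivialDisconnectedSubinterval u w) :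
    HasNontrivialDisconnectedSubinterval (f u) (f w) := by
  obtain ⟨x, y, h1, h2, h3, h4, A, B, hA, hB, hAB, hun, hF⟩ := h
  have hfy : Set.Iic (f y) ⊆ Set.range f := (Set.Iic_subset_Iic.2 (f.le_iff_le.2 h3)).trans hf
  refine ⟨f x, f y, f.le_iff_le.2 h1, f.le_iff_le.2 h2, f.le_iff_le.2 h3, ?_, f '' A, f '' B,
    hA.image f, hB.image f, (Set.disjoint_image_iff f.injective).2 hAB, ?_, ?_⟩
  · refine h4.trans (Order.krullDim_le_of_strictMono
      (fun q => ⟨f q.1, f.le_iff_le.2 q.2.1, f.le_iff_le.2 q.2.2⟩) fun a b hab => ?_)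
    exact f.lt_iff_lt.2 hab
  · rw [← Set.image_union, hun, image_Ioo_of_range f hfy]
  · rw [← image_Ioo_of_range f hfy, orderComplex_image]
    rintro _ ⟨G, hG, rfl⟩
    rw [Finset.coe_map]
    exact (hF G hG).imp (fun h => Set.image_mono h) (fun h => Set.image_mono h)

end Transfer

/-! ### Generalized subword order on lists -/

section Subwords

variable {P : Type*} [PartialOrder P]

local infix:50 " ≼ " => List.SublistForall₂ (· ≤ ·)

theorem subword_refl (u : List P) : u ≼ u := refl u

theorem subword_trans {u v w : List P} (h : u ≼ v) (h' : v ≼ w) : u ≼ w := _root_.trans h h'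

theorem subword_cons_cons {a b : P} {u w : List P} :
    a :: u ≼ b :: w ↔ a :: u ≼ w ∨ (a ≤ b ∧ u ≼ w) := by
  constructor
  · intro h
    cases h with
    | cons h1 h2 => exact Or.inr ⟨h1, h2⟩
    | cons_right h => exact Or.inl h
  · rintro (h | ⟨h1, h2⟩)
    · exact .cons_right h
    · exact .cons h1 h2

theorem subword_of_cons {a : P} {u w : List P} (h : a :: u ≼ w) : u ≼ w :=
  subword_trans (.cons_right (subword_refl u)) h

theorem subword_nil_iff {u : List P} : u ≼ [] ↔ u = [] := by
  constructor
  · intro h; cases h; rfl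
  · rintro rfl; exact .nil

theorem subword_length_le {u w : List P} (h : u ≼ w) : u.length ≤ w.length := by
  induction h with
  | nil => simp
  | cons _ _ ih => simpa using ih
  | cons_right _ ih => simp; omega

theorem forall₂_le_of_subword {u w : List P} (h : u ≼ w) (hl : u.length = w.length) :
    List.Forall₂ (· ≤ ·) u w := by
  obtain ⟨l, h1, h2⟩ := List.sublistForall₂_iff.1 h
  have := h1.length_eq
  rwa [h2.eq_of_length (by omega)] at h1

theorem subword_append_left (l : List P) {u w : List P} (h : u ≼ w) : l ++ u ≼ l ++ w := by
  induction l with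
  | nil => exact h
  | cons a l ih => exact .cons le_rfl ih

/-- If `u` is obtained from a subword of `v` that omits just one letter, then the omitted letter
stands either after the first `k + 1` letters or among them. -/
theorem forall₂_take_or_drop {u v : List P} (h : u ≼ v) (hl : v.length = u.length + 1) (k : ℕ) :
    List.Forall₂ (· ≤ ·) (u.take (k + 1)) (v.take (k + 1)) ∨
      List.Forall₂ (· ≤ ·) (u.drop k) (v.drop (k + 1)) := by
  induction u generalizing v k with
  | nil =>
    right
    rw [List.drop_nil, List.drop_eq_nil_of_le (by simp at hl; omega)]
    exact .nil
  | cons a u ih =>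
    obtain ⟨c, v, rfl⟩ := List.exists_cons_of_length_eq_add_one hl
    rw [List.length_cons, Nat.add_right_cancel_iff] at hl
    rcases subword_cons_cons.1 h with h | ⟨h1, h2⟩
    · right
      rw [List.drop_succ_cons]
      exact List.forall₂_drop k (forall₂_le_of_subword h hl.symm)
    · cases k with
      | zero => left; simpa using h1
      | succ k =>
        rcases ih h2 hl k with h | h
        · left
          rw [List.take_succ_cons, List.take_succ_cons]
          exact .cons h1 h
        · right
          exact h

theorem forall₂_le_trans : ∀ {u v w : List P}, List.Forall₂ (· ≤ ·) u v →
    List.Forall₂ (· ≤ ·) v w → List.Forall₂ (· ≤ ·) u w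
  | _, _, _, .nil, .nil => .nil
  | _, _, _, .cons h1 h2, .cons h3 h4 => .cons (h1.trans h3) (forall₂_le_trans h2 h4)

/-! ### A family of disconnected intervals -/

/-- If the letter `b` has rank at least `3`, then `[αbβ, αbbβ]` is a non-trivial disconnected
interval: every element of the open interval either ends with `bβ` or begins with `αb`, and
no element of the first kind is comparable to one of the second kind. -/
theorem hasNontrivialDisconnectedSubinterval_of_double {α β : List P} {a₁ a₂ b : P} (h₁ : a₁ < a₂)
    (h₂ : a₂ < b) {u w : Word P} (hu : u ≤ ⟨α ++ b :: β⟩) (hw : ⟨α ++ b :: b :: β⟩ ≤ w) :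
    HasNontrivialDisconnectedSubinterval u w := by
  set x : Word P := ⟨α ++ b :: β⟩ with hx
  set y : Word P := ⟨α ++ b :: b :: β⟩ with hy
  have key : ∀ c < b, x < ⟨α ++ c :: b :: β⟩ ∧ (⟨α ++ c :: b :: β⟩ : Word P) < y ∧
      x < ⟨α ++ b :: c :: β⟩ ∧ (⟨α ++ b :: c :: β⟩ : Word P) < y := by
    intro c hc
    refine ⟨lt_of_le_of_ne ?_ ?_, lt_of_le_of_ne ?_ ?_, lt_of_le_of_ne ?_ ?_,
      lt_of_le_of_ne ?_ ?_⟩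
    · exact (Word.le_iff _ _).2 (subword_append_left _ (.cons_right (subword_refl _)))
    · intro h
      simpa [hx] using congrArg (fun v : Word P => v.letters.length) h
    · exact (Word.le_iff _ _).2 (subword_append_left _ (.cons hc.le (subword_refl _)))
    · intro h
      simp [hy, hc.ne] at h
    · exact (Word.le_iff _ _).2 (subword_append_left _ (.cons le_rfl (.cons_right (subword_refl _))))
    · intro h
      simpa [hx] using congrArg (fun v : Word P => v.letters.length) h
    · exact (Word.le_iff _ _).2
        (subword_append_left _ (.cons le_rfl (.cons hc.le (subword_refl _))))
    · intro h
      simp [hy, hc.ne] at h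
  set p := α.length with hp
  have tx : x.letters.take (p + 1) = α ++ [b] := by simp [hx, hp, List.take_append]
  have dx : x.letters.drop p = b :: β := by simp [hx, hp]
  have ty : y.letters.take (p + 1) = α ++ [b] := by simp [hy, hp, List.take_append]
  have dy : y.letters.drop (p + 1) = b :: β := by simp [hy, hp, List.drop_append]
  have lx : x.letters.length = p + β.length + 1 := by simp [hx, hp]; omega
  have ly : y.letters.length = p + β.length + 2 := by simp [hy, hp]; omega
  have hlen : ∀ v ∈ Set.Ioo x y, v.letters.length = p + β.length + 1 ∨
      v.letters.length = p + β.length + 2 := by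
    intro v hv
    have h1 := subword_length_le ((Word.le_iff _ _).1 hv.1.le)
    have h2 := subword_length_le ((Word.le_iff _ _).1 hv.2.le)
    omega
  -- `InA v`: the word `v` ends with `bβ`; `InB v`: it begins with `αb`
  let InA : Word P → Prop := fun v => v.letters.drop (v.letters.length - (β.length + 1)) = b :: β
  let InB : Word P → Prop := fun v => v.letters.take (p + 1) = α ++ [b]
  have hor : ∀ v ∈ Set.Ioo x y, InA v ∨ InB v := by
    intro v hv
    have h1 := (Word.le_iff _ _).1 hv.1.le
    have h2 := (Word.le_iff _ _).1 hv.2.le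
    rcases hlen v hv with hl | hl
    · have h3 := forall₂_le_of_subword h1 (by omega)
      rcases forall₂_take_or_drop h2 (by omega) p with h | h
      · right
        rw [ty] at h
        have h4 := List.forall₂_take (p + 1) h3
        rw [tx] at h4
        exact forall₂_le_antisymm _ _ h h4
      · left
        rw [dy] at h
        have h4 := List.forall₂_drop p h3
        rw [dx] at h4
        simp only [InA, hl, show p + β.length + 1 - (β.length + 1) = p by omega]
        exact forall₂_le_antisymm _ _ h h4
    · have h3 := forall₂_le_of_subword h2 (by omega)
      rcases forall₂_take_or_drop h1 (by omega) p with h | h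
      · right
        rw [tx] at h
        have h4 := List.forall₂_take (p + 1) h3
        rw [ty] at h4
        exact forall₂_le_antisymm _ _ h4 h
      · left
        rw [dx] at h
        have h4 := List.forall₂_drop (p + 1) h3
        rw [dy] at h4
        simp only [InA, hl, show p + β.length + 2 - (β.length + 1) = p + 1 by omega]
        exact forall₂_le_antisymm _ _ h4 h
  have hnot : ∀ v ∈ Set.Ioo x y, InA v → InB v → False := by
    intro v hv hA hB
    simp only [InA, InB] at hA hB
    rcases hlen v hv with hl | hl
    · rw [hl, show p + β.length + 1 - (β.length + 1) = p by omega] at hA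
      refine hv.1.ne (Word.ext ?_)
      rw [← List.take_append_drop p v.letters, hA]
      have : v.letters.take p = (v.letters.take (p + 1)).take p := by simp [List.take_take]
      rw [this, hB, List.take_append]
      simp [hp, hx]
    · rw [hl, show p + β.length + 2 - (β.length + 1) = p + 1 by omega] at hA
      refine hv.2.ne (Word.ext ?_)
      rw [← List.take_append_drop (p + 1) v.letters, hA, hB]
      simp [hy]
  -- `v` and `v'` are squeezed between `x` and `y`, letter by letter
  have hcross : ∀ v ∈ Set.Ioo x y, ∀ v' ∈ Set.Ioo x y, v ≤ v' →
      (InA v ∧ InA v') ∨ (InB v ∧ InB v') := by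
    intro v hv v' hv' hle
    have hxv := (Word.le_iff _ _).1 hv.1.le
    have hvv := (Word.le_iff _ _).1 hle
    have hvy := (Word.le_iff _ _).1 hv'.2.le
    have hll := subword_length_le hvv
    rcases hlen v hv with hl | hl <;> rcases hlen v' hv' with hl' | hl'
    · have h3 := forall₂_le_of_subword hxv (by omega)
      have h4 := forall₂_le_of_subword hvv (by omega)
      rcases hor v' hv' with h | h
      · left
        refine ⟨?_, h⟩
        simp only [InA, hl, hl', show p + β.length + 1 - (β.length + 1) = p by omega] at h ⊢
        have h5 := List.forall₂_drop p h3
        have h6 := List.forall₂_drop p h4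
        rw [dx] at h5
        rw [h] at h6
        exact forall₂_le_antisymm _ _ h6 h5
      · right
        refine ⟨?_, h⟩
        simp only [InB] at h ⊢
        have h5 := List.forall₂_take (p + 1) h3
        have h6 := List.forall₂_take (p + 1) h4
        rw [tx] at h5
        rw [h] at h6
        exact forall₂_le_antisymm _ _ h6 h5
    · have h3 := forall₂_le_of_subword hxv (by omega)
      have h4 := forall₂_le_of_subword hvy (by omega)
      simp only [InA, InB, hl, hl', show p + β.length + 1 - (β.length + 1) = p by omega,
        show p + β.length + 2 - (β.length + 1) = p + 1 by omega]
      rcases forall₂_take_or_drop hvv (by omega) p with h | h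
      · right
        have h5 := List.forall₂_take (p + 1) h3
        have h6 := List.forall₂_take (p + 1) h4
        rw [tx] at h5
        rw [ty] at h6
        exact ⟨forall₂_le_antisymm _ _ (forall₂_le_trans h h6) h5,
          forall₂_le_antisymm _ _ h6 (forall₂_le_trans h5 h)⟩
      · left
        have h5 := List.forall₂_drop p h3
        have h6 := List.forall₂_drop (p + 1) h4
        rw [dx] at h5
        rw [dy] at h6
        exact ⟨forall₂_le_antisymm _ _ (forall₂_le_trans h h6) h5,
          forall₂_le_antisymm _ _ h6 (forall₂_le_trans h5 h)⟩
    · omega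
    · have h3 := forall₂_le_of_subword hvy (by omega)
      have h4 := forall₂_le_of_subword hvv (by omega)
      rcases hor v hv with h | h
      · left
        refine ⟨h, ?_⟩
        simp only [InA, hl, hl', show p + β.length + 2 - (β.length + 1) = p + 1 by omega] at h ⊢
        have h5 := List.forall₂_drop (p + 1) h3
        have h6 := List.forall₂_drop (p + 1) h4
        rw [dy] at h5
        rw [h] at h6
        exact forall₂_le_antisymm _ _ h5 h6
      · right
        refine ⟨h, ?_⟩
        simp only [InB] at h ⊢
        have h5 := List.forall₂_take (p + 1) h3
        have h6 := List.forall₂_take (p + 1) h4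
        rw [ty] at h5
        rw [h] at h6
        exact forall₂_le_antisymm _ _ h5 h6
  have k1 := key a₁ (h₁.trans h₂)
  have k2 := key a₂ h₂
  have hlt12 : (⟨α ++ a₁ :: b :: β⟩ : Word P) < ⟨α ++ a₂ :: b :: β⟩ := by
    refine lt_of_le_of_ne
      ((Word.le_iff _ _).2 (subword_append_left _ (.cons h₁.le (subword_refl _)))) ?_
    intro h
    simp [h₁.ne] at h
  have hxy : x ≤ y := (k1.1.trans k1.2.1).le
  refine ⟨x, y, hu, hxy, hw, ?_, {v | v ∈ Set.Ioo x y ∧ InA v}, {v | v ∈ Set.Ioo x y ∧ InB v},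
    ⟨_, ⟨k2.1, k2.2.1⟩, ?_⟩, ⟨_, ⟨k2.2.2.1, k2.2.2.2⟩, ?_⟩, ?_, ?_, ?_⟩
  · let f : Fin 4 → Set.Icc x y := ![⟨x, le_rfl, hxy⟩, ⟨_, k1.1.le, k1.2.1.le⟩,
      ⟨_, k2.1.le, k2.2.1.le⟩, ⟨y, hxy, le_rfl⟩]
    have hf : StrictMono f := by
      rw [Fin.strictMono_iff_lt_succ]
      intro i
      fin_cases i
      exacts [k1.1, hlt12, k2.2.1]
    exact Order.LTSeries.length_le_krullDim (LTSeries.mk 3 f hf)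
  · simp only [InA, List.length_append, List.length_cons, ← hp]
    rw [show p + (β.length + 1 + 1) - (β.length + 1) = p + 1 by omega]
    simp [hp, List.drop_append]
  · simp [InB, hp, List.take_append]
  · rw [Set.disjoint_left]
    exact fun v h h' => hnot v h.1 h.2 h'.2
  · ext v
    exact ⟨fun h => h.elim (fun h => h.1) (fun h => h.1),
      fun h => (hor v h).imp (fun h' => ⟨h, h'⟩) (fun h' => ⟨h, h'⟩)⟩
  · rintro F ⟨hF, hFc⟩
    by_contra! hcon
    obtain ⟨⟨v, hv, hvA⟩, ⟨v', hv', hvB⟩⟩ := hcon.imp Set.not_subset.1 Set.not_subset.1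
    have a1 : ¬ InA v := fun h => hvA ⟨hF hv, h⟩
    have a2 : ¬ InB v' := fun h => hvB ⟨hF hv', h⟩
    rcases hFc.total hv hv' with h | h
    · rcases hcross v (hF hv) v' (hF hv') h with h | h
      exacts [a1 h.1, a2 h.2]
    · rcases hcross v' (hF hv') v (hF hv) h with h | h
      exacts [a1 h.2, a2 h.1]

end Subwords

/-! ### Covering relations of generalized subword order -/

section Reductions

variable {P : Type*} [PartialOrder P]

local infix:50 " ≼ " => List.SublistForall₂ (· ≤ ·)

theorem IsRootedForest.le_of_covBy (hP : IsRootedForest P) {a b c : P} (hab : a ⋖ b) (hc : c < b) :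
    c ≤ a := by
  rcases (hP b).2.total (x := a) (y := c) hab.le hc.le with h | h
  · rcases h.eq_or_lt with rfl | h
    · exact le_rfl
    · exact absurd hc (hab.2 h)
  · exact h

theorem IsRootedForest.covBy_unique (hP : IsRootedForest P) {a a' b : P} (h : a ⋖ b)
    (h' : a' ⋖ b) : a = a' :=
  le_antisymm (hP.le_of_covBy h' h.lt) (hP.le_of_covBy h h'.lt)

theorem IsRootedForest.exists_covBy (hP : IsRootedForest P) {b : P} (hb : ¬ IsMin b) :
    ∃ a, a ⋖ b := by
  obtain ⟨c, hc⟩ := not_isMin_iff.1 hb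
  have hfin : (Set.Iio b).Finite := (hP b).1.subset Set.Iio_subset_Iic_self
  obtain ⟨a, ha⟩ := hfin.exists_maximal ⟨c, hc⟩
  exact ⟨a, ha.1, fun d h1 h2 => (ha.2 h2 h1.le).not_gt h1⟩

/-- `Reduces y i z`: the word `z` is obtained from `y` by reducing its letter of index `i` (counted
from `0`), that is, by replacing it by a letter that it covers or, if it is minimal, by
deleting it. -/
inductive Reduces : List P → ℕ → List P → Prop
  | lower {a b : P} {l : List P} : a ⋖ b → Reduces (b :: l) 0 (a :: l)
  | delete {b : P} {l : List P} : IsMin b → Reduces (b :: l) 0 l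
  | cons {b : P} {l l' : List P} {i : ℕ} : Reduces l i l' → Reduces (b :: l) (i + 1) (b :: l')

theorem Reduces.subword {y z : List P} {i : ℕ} (h : Reduces y i z) : z ≼ y := by
  induction h with
  | lower h => exact .cons h.le (subword_refl _)
  | delete h => exact .cons_right (subword_refl _)
  | cons h ih => exact .cons le_rfl ih

theorem Reduces.append (l : List P) {y z : List P} {i : ℕ} (h : Reduces y i z) :
    Reduces (l ++ y) (l.length + i) (l ++ z) := by
  induction l with
  | nil => simpa using h
  | cons a l ih =>
    rw [List.length_cons, Nat.add_right_comm]
    exact ih.cons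

theorem Reduces.unique (hP : IsRootedForest P) {y z z' : List P} {i : ℕ} (h : Reduces y i z)
    (h' : Reduces y i z') : z = z' := by
  induction h generalizing z' with
  | lower h =>
    cases h' with
    | lower h' => rw [hP.covBy_unique h h']
    | delete h' => exact absurd h.lt h'.not_lt
  | delete h =>
    cases h' with
    | lower h' => exact absurd h'.lt h.not_lt
    | delete h' => rfl
  | cons h ih =>
    cases h' with
    | cons h' => rw [ih h']

/-- The first letter of a word can be reduced, and every word that has an embedding not
using the whole of this letter is still contained in the result. -/
theorem exists_reduces_zero (hP : IsRootedForest P) (b : P) (l : List P) :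
    ∃ z, Reduces (b :: l) 0 z ∧ l ≼ z ∧ ∀ a u, a < b → u ≼ l → a :: u ≼ z := by
  by_cases hb : IsMin b
  · exact ⟨l, .delete hb, subword_refl _, fun a u h => absurd h hb.not_lt⟩
  · obtain ⟨c, hc⟩ := hP.exists_covBy hb
    exact ⟨c :: l, .lower hc, .cons_right (subword_refl _),
      fun a u h h' => .cons (hP.le_of_covBy hc h) h'⟩

theorem exists_reduces_of_subword (hP : IsRootedForest P) {x y : List P} (h : x ≼ y)
    (hne : x ≠ y) : ∃ i z, Reduces y i z ∧ x ≼ z := by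
  induction y generalizing x with
  | nil => exact absurd (subword_nil_iff.1 h) hne
  | cons b l ih =>
    obtain ⟨z, hz, hz1, hz2⟩ := exists_reduces_zero hP b l
    cases x with
    | nil => exact ⟨0, z, hz, .nil⟩
    | cons a u =>
      rcases subword_cons_cons.1 h with h | ⟨h1, h2⟩
      · exact ⟨0, z, hz, subword_trans h hz1⟩
      · rcases h1.eq_or_lt with rfl | h1
        · obtain ⟨i, z, hz, hu⟩ := ih h2 (fun h => hne (by rw [h]))
          exact ⟨i + 1, a :: z, hz.cons, .cons le_rfl hu⟩
        · exact ⟨0, z, hz, hz2 a u h1 h2⟩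

/-- The rank of a word: the sum of the ranks of its letters, where a minimal letter has
rank `1`. -/
noncomputable def wordRank (l : List P) : ℕ :=
  (l.map fun b => (Set.Iic b).ncard).sum

theorem Reduces.wordRank_add_one (hP : IsRootedForest P) {y z : List P} {i : ℕ}
    (h : Reduces y i z) : wordRank z + 1 = wordRank y := by
  induction h with
  | @lower a b l h =>
    have h1 : Set.Iic b = insert b (Set.Iic a) := by
      ext c
      simp only [Set.mem_Iic, Set.mem_insert_iff]
      constructor
      · intro hc
        exact hc.eq_or_lt.imp_right fun hc => hP.le_of_covBy h hc
      · rintro (rfl | hc)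
        exacts [le_rfl, hc.trans h.le]
    have h2 : (Set.Iic b).ncard = (Set.Iic a).ncard + 1 := by
      rw [h1, Set.ncard_insert_of_notMem (show b ∉ Set.Iic a from h.lt.not_ge) (hP a).1]
    simp only [wordRank, List.map_cons, List.sum_cons, h2]
    omega
  | @delete b l h =>
    have h1 : Set.Iic b = {b} := by
      ext c
      exact ⟨fun hc => h.eq_of_le hc, fun hc => hc.le⟩
    simp only [wordRank, List.map_cons, List.sum_cons, h1, Set.ncard_singleton]
    omega
  | cons h ih =>
    simp only [wordRank, List.map_cons, List.sum_cons] at ih ⊢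
    omega

theorem wordRank_lt_of_subword (hP : IsRootedForest P) {x y : List P} (h : x ≼ y) (hne : x ≠ y) :
    wordRank x < wordRank y := by
  induction hn : wordRank y using Nat.strong_induction_on generalizing y with
  | _ n ih =>
    subst hn
    obtain ⟨i, z, hz, hxz⟩ := exists_reduces_of_subword hP h hne
    have h1 := hz.wordRank_add_one hP
    by_cases hxz' : x = z
    · subst hxz'; omega
    · have := ih _ (by omega) hxz hxz' rfl
      omega

theorem covBy_iff_reduces (hP : IsRootedForest P) {v y : Word P} :
    v ⋖ y ↔ ∃ i, Reduces y.letters i v.letters := by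
  constructor
  · intro h
    obtain ⟨i, z, hz, hvz⟩ := exists_reduces_of_subword hP ((Word.le_iff _ _).1 h.le)
      (fun he => h.ne (Word.ext he))
    have h1 : v ≤ ⟨z⟩ := (Word.le_iff _ _).2 hvz
    have h2 : (⟨z⟩ : Word P) ≤ y := (Word.le_iff _ _).2 hz.subword
    have h3 := hz.wordRank_add_one hP
    rcases h.eq_or_eq h1 h2 with he | he
    · exact ⟨i, by rw [← he]; exact hz⟩
    · rw [← he] at h3
      simp at h3
  · rintro ⟨i, hi⟩
    have h3 := hi.wordRank_add_one hP
    have hle : v ≤ y := (Word.le_iff _ _).2 hi.subword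
    refine ⟨lt_of_le_of_ne hle (by rintro rfl; simp at h3), fun z h1 h2 => ?_⟩
    have h4 := wordRank_lt_of_subword hP ((Word.le_iff _ _).1 h1.le) (fun he => h1.ne (Word.ext he))
    have h5 := wordRank_lt_of_subword hP ((Word.le_iff _ _).1 h2.le) (fun he => h2.ne (Word.ext he))
    omega

/-- Reductions at different places commute, as far as needed here: if `y₂` is reached from `y` by
reducing at `i` first and then further to the left, at `j`, then the latter reduction is possible
in `y` already. -/
theorem Reduces.exists_of_lt {y y₁ y₂ : List P} {i j : ℕ} (h : Reduces y i y₁)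
    (h' : Reduces y₁ j y₂) (hji : j < i) : ∃ z, Reduces y j z ∧ y₂ ≼ z := by
  induction h generalizing j y₂ with
  | lower h => omega
  | delete h => omega
  | cons h ih =>
    cases h' with
    | lower h1 => exact ⟨_, .lower h1, .cons le_rfl h.subword⟩
    | delete h1 => exact ⟨_, .delete h1, h.subword⟩
    | cons h1 =>
      obtain ⟨z, hz, hz'⟩ := ih h1 (by omega)
      exact ⟨_, hz.cons, .cons le_rfl hz'⟩

/-- If the second of two adjacent equal letters is lowered and then deleted, then the result is also
below the word in which the first of the two letters has been reduced. -/
theorem Reduces.exists_of_double {y y₁ y₂ : List P} {i : ℕ} {b : P} (h : Reduces y i y₁)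
    (hl : y₁.length = y.length) (h' : Reduces y₁ i y₂) (hl' : y₂.length < y₁.length)
    (hi : 0 < i) (hb : y[i]? = some b) (hb' : y[i - 1]? = some b) :
    ∃ z, Reduces y (i - 1) z ∧ y₂ ≼ z := by
  induction h generalizing y₂ with
  | lower h => omega
  | delete h => omega
  | @cons c l l' i h ih =>
    cases h' with
    | @cons _ _ l₂ _ h' =>
      cases i with
      | zero =>
        cases h with
        | @lower a b' l h =>
          simp at hb hb'
          subst hb hb'
          cases h' with
          | lower h1 => simp at hl'
          | delete h1 => exact ⟨_, .lower h, .cons_right (subword_refl _)⟩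
        | delete h => simp at hl
      | succ i =>
        obtain ⟨z, hz, hz'⟩ := ih (by simpa using hl) h' (by simpa using hl') (by omega)
          (by simpa using hb) (by simpa using hb')
        exact ⟨c :: z, hz.cons, .cons le_rfl hz'⟩

/-- Let `y'` be obtained from `y` by reducing the letter of index `j`, let `x` be contained in `y'`,
and suppose that a letter of `y` to the left of this one can be reduced as well without losing `x`.
Then a letter to the left of `j` can be reduced in `y'` without losing `x`, unless the letters
of `y` of index `j - 1` and `j` are equal and one of them can be omitted without losing `x`. -/
theorem Reduces.exists_lt_or_double (hP : IsRootedForest P) {x y y' z : List P} {i j : ℕ}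
    (hy' : Reduces y j y') (hx : x ≼ y') (hz : Reduces y i z) (hxz : x ≼ z) (hij : i < j) :
    (∃ i' < j, ∃ z', Reduces y' i' z' ∧ x ≼ z') ∨
      ∃ α b β, y = α ++ b :: b :: β ∧ j = α.length + 1 ∧ x ≼ α ++ b :: β := by
  induction y generalizing x y' z i j with
  | nil => cases hz
  | cons b₁ t ih =>
    cases hy' with
    | lower h => omega
    | delete h => omega
    | @cons _ _ t' j ht' =>
    obtain ⟨z₀, hz₀, hz₁, hz₂⟩ := exists_reduces_zero hP b₁ t'
    by_cases hxt : x ≼ t'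
    · exact Or.inl ⟨0, by omega, z₀, hz₀, subword_trans hxt hz₁⟩
    cases x with
    | nil => exact absurd .nil hxt
    | cons a x =>
    obtain ⟨hab, hxt'⟩ := (subword_cons_cons.1 hx).resolve_left hxt
    rcases hab.eq_or_lt with rfl | hab
    swap
    · exact Or.inl ⟨0, by omega, z₀, hz₀, hz₂ a x hab hxt'⟩
    -- now `x` starts with the first letter of `y`, which it needs completely in `y'`
    have hcons : (∃ i' < j, ∃ z', Reduces t' i' z' ∧ x ≼ z') ∨
        (∃ α b β, t = α ++ b :: b :: β ∧ j = α.length + 1 ∧ x ≼ α ++ b :: β) →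
        (∃ i' < j + 1, ∃ z', Reduces (a :: t') i' z' ∧ a :: x ≼ z') ∨
        ∃ α b β, a :: t = α ++ b :: b :: β ∧ j + 1 = α.length + 1 ∧ a :: x ≼ α ++ b :: β := by
      rintro (⟨i', hi', z', hz', hxz'⟩ | ⟨α, b, β, rfl, rfl, hxα⟩)
      · exact Or.inl ⟨i' + 1, by omega, _, hz'.cons, .cons le_rfl hxz'⟩
      · exact Or.inr ⟨a :: α, b, β, rfl, rfl, .cons le_rfl hxα⟩
    have hcase : a :: x ≼ t ∨ ∃ i' z', i' < j ∧ Reduces t i' z' ∧ x ≼ z' := by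
      cases hz with
      | lower hc =>
        rcases subword_cons_cons.1 hxz with h | ⟨h1, h2⟩
        · exact Or.inl h
        · exact absurd hc.lt h1.not_gt
      | delete hb => exact Or.inl hxz
      | @cons _ _ z i hz =>
        refine Or.inr ⟨i, z, by omega, hz, ?_⟩
        rcases subword_cons_cons.1 hxz with h | ⟨h1, h2⟩
        exacts [subword_of_cons h, h2]
    rcases hcase with hat | ⟨i', z', hi', hz', hxz'⟩
    swap
    · exact hcons (ih ht' hxt' hz' hxz' hi')
    cases ht' with
    | @lower c b₂ s hc =>
      rcases subword_cons_cons.1 hat with h | ⟨h1, h2⟩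
      · exact absurd (.cons_right h) hxt
      · rcases h1.eq_or_lt with rfl | h1
        · exact Or.inr ⟨[], a, s, rfl, rfl, .cons le_rfl h2⟩
        · exact absurd (.cons (hP.le_of_covBy hc h1) h2) hxt
    | @delete b₂ s hb =>
      rcases subword_cons_cons.1 hat with h | ⟨h1, h2⟩
      · exact absurd h hxt
      · obtain rfl := hb.eq_of_le h1
        exact Or.inr ⟨[], a, t', rfl, rfl, .cons le_rfl h2⟩
    | @cons b₂ s s' j hs' =>
      have hxs : x ≼ s := by
        rcases subword_cons_cons.1 hat with h | ⟨h1, h2⟩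
        exacts [subword_of_cons h, h2]
      obtain ⟨z₃, hz₃, hz₄, -⟩ := exists_reduces_zero hP b₂ s
      exact hcons (ih hs'.cons hxt' hz₃ (subword_trans hxs hz₄) (by omega))

end Reductions

/-! ### The index of a step -/

section Steps

variable {P : Type*}

/-- If erasing the letter of index `j ≤ i` gives the same result as erasing that of index `i`, then
the two letters are equal. -/
theorem getElem?_eq_of_eraseIdx_eq {y : List P} {i j : ℕ} (hji : j ≤ i) (hi : i < y.length)
    (h : y.eraseIdx j = y.eraseIdx i) : y[j]? = y[i]? := by
  induction i with
  | zero => rw [Nat.le_zero.1 hji]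
  | succ i ih =>
    rcases hji.eq_or_lt with rfl | hji
    · rfl
    have h1 : y[i + 1]? = y[i]? := by
      have := congrArg (fun l => l[i]?) h
      simpa [List.getElem?_eraseIdx, show ¬ i < j by omega] using this
    have h2 : y.eraseIdx i = y.eraseIdx (i + 1) := by
      apply List.ext_getElem?
      intro k
      simp only [List.getElem?_eraseIdx]
      rcases lt_trichotomy k i with hk | rfl | hk
      · simp [hk, hk.trans (Nat.lt_succ_self i)]
      · simpa using h1
      · simp [show ¬ k < i by omega, show ¬ k < i + 1 by omega]
    rw [h1]
    exact ih (by omega) (by omega) (h.trans h2.symm)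

theorem pairwise_stepPositions {pos : List ℕ} (y v : Word P) (h : pos.Pairwise (· < ·)) :
    (stepPositions pos y v).Pairwise (· < ·) := by
  rw [stepPositions]
  split_ifs
  · exact h
  · exact h.sublist (List.eraseIdx_sublist _ _)

theorem getD_stepPositions_of_lt (pos : List ℕ) {y v : Word P} {j : ℕ} (hj : j < stepIndex y v) :
    (stepPositions pos y v).getD j 0 = pos.getD j 0 := by
  rw [stepPositions]
  split_ifs
  · rfl
  · simp [List.getD_eq_getElem?_getD, List.getElem?_eraseIdx, hj]

variable [PartialOrder P]

local infix:50 " ≼ " => List.SublistForall₂ (· ≤ ·)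

theorem Reduces.lt_length {y z : List P} {i : ℕ} (h : Reduces y i z) : i < y.length := by
  induction h with
  | lower h => simp
  | delete h => simp
  | cons h ih => simpa using ih

theorem Reduces.length_or {y z : List P} {i : ℕ} (h : Reduces y i z) :
    z.length = y.length ∨ z.length + 1 = y.length := by
  induction h with
  | lower h => simp
  | delete h => simp
  | cons h ih => simpa using ih

theorem Reduces.getElem?_ne_iff {y z : List P} {i : ℕ} (h : Reduces y i z)
    (hl : z.length = y.length) (j : ℕ) : y[j]? ≠ z[j]? ↔ j = i := by
  induction h generalizing j with
  | lower h => cases j <;> simp [h.lt.ne']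
  | delete h => simp at hl
  | cons h ih =>
    cases j with
    | zero => simp
    | succ j => simpa using ih (by simpa using hl) j

theorem Reduces.eraseIdx_eq {y z : List P} {i : ℕ} (h : Reduces y i z)
    (hl : z.length ≠ y.length) : y.eraseIdx i = z ∧ ∃ b, y[i]? = some b ∧ IsMin b := by
  induction h with
  | lower h => simp at hl
  | delete h => simpa using h
  | cons h ih => simpa using ih (by simpa using hl)

theorem reduces_eraseIdx {y : List P} {i : ℕ} {b : P} (h : y[i]? = some b) (hb : IsMin b) :
    Reduces y i (y.eraseIdx i) := by
  induction y generalizing i with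
  | nil => simp at h
  | cons a y ih =>
    cases i with
    | zero =>
      obtain rfl : a = b := by simpa using h
      exact .delete hb
    | succ i => exact (ih (by simpa using h)).cons

/-- The index of a step of a chain is the least index of a letter whose reduction gives this
step. -/
theorem Reduces.stepIndex {y z : List P} {i : ℕ} (h : Reduces y i z) :
    stepIndex ⟨y⟩ ⟨z⟩ ≤ i ∧ Reduces y (stepIndex ⟨y⟩ ⟨z⟩) z := by
  by_cases hl : z.length = y.length
  · have : SubwordShelling.stepIndex ⟨y⟩ ⟨z⟩ = i := by
      rw [SubwordShelling.stepIndex, if_pos hl]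
      simp only [h.getElem?_ne_iff hl]
      exact csInf_singleton i
    rw [this]
    exact ⟨le_rfl, h⟩
  · obtain ⟨h1, b, h2, hb⟩ := h.eraseIdx_eq hl
    rw [SubwordShelling.stepIndex, if_neg hl]
    have hmem : i ∈ {j | j < y.length ∧ y.eraseIdx j = z} := ⟨h.lt_length, h1⟩
    have hle := Nat.sInf_le hmem
    have hin := Nat.sInf_mem ⟨i, hmem⟩
    refine ⟨hle, ?_⟩
    have := getElem?_eq_of_eraseIdx_eq hle h.lt_length (hin.2.trans h1.symm)
    have h3 := reduces_eraseIdx (this.trans h2) hb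
    rwa [hin.2] at h3

theorem reduces_stepIndex (hP : IsRootedForest P) {y v : Word P} (h : v ⋖ y) :
    Reduces y.letters (stepIndex y v) v.letters := by
  obtain ⟨i, hi⟩ := (covBy_iff_reduces hP).1 h
  exact hi.stepIndex.2

theorem Reduces.covBy (hP : IsRootedForest P) {y z : List P} {i : ℕ} (h : Reduces y i z) :
    (⟨z⟩ : Word P) ⋖ ⟨y⟩ :=
  (covBy_iff_reduces hP).2 ⟨i, h⟩

/-! ### Labels of edges -/

theorem length_stepPositions (hP : IsRootedForest P) {pos : List ℕ} {y v : Word P} (h : v ⋖ y)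
    (hpos : pos.length = y.letters.length) : (stepPositions pos y v).length = v.letters.length := by
  have h1 := reduces_stepIndex hP h
  rw [stepPositions]
  split_ifs with hl
  · rw [hpos, hl]
  · rw [List.length_eraseIdx, if_pos (by rw [hpos]; exact h1.lt_length), hpos]
    have := h1.length_or
    omega

theorem getD_add_one_le {pos : List ℕ} (h : pos.Pairwise (· < ·)) {i j : ℕ} (hij : i < j)
    (hj : j < pos.length) : (pos.getD i 0 : ℚ) + 1 ≤ pos.getD j 0 := by
  have := List.pairwise_iff_getElem.1 h i j (hij.trans hj) hj hij
  rw [List.getD_eq_getElem _ _ hj, List.getD_eq_getElem _ _ (hij.trans hj)]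
  exact_mod_cast this

theorem modifiedEdgeLabel_le (prev : Option (Word P)) (pos : List ℕ) (y v : Word P) :
    modifiedEdgeLabel prev pos y v ≤ pos.getD (stepIndex y v) 0 := by
  rw [modifiedEdgeLabel]
  split_ifs <;> linarith

theorem sub_half_le_modifiedEdgeLabel (prev : Option (Word P)) (pos : List ℕ) (y v : Word P) :
    (pos.getD (stepIndex y v) 0 : ℚ) - 1 / 2 ≤ modifiedEdgeLabel prev pos y v := by
  rw [modifiedEdgeLabel]
  split_ifs <;> linarith

theorem modifiedEdgeLabel_lt {prev : Option (Word P)} {pos : List ℕ} {y v v' : Word P}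
    (hP : IsRootedForest P) (hpos : pos.Pairwise (· < ·)) (hlen : pos.length = y.letters.length)
    (hv' : v' ⋖ y) (h : stepIndex y v < stepIndex y v') :
    modifiedEdgeLabel prev pos y v < modifiedEdgeLabel prev pos y v' := by
  have h1 := modifiedEdgeLabel_le prev pos y v
  have h2 := sub_half_le_modifiedEdgeLabel prev pos y v'
  have h3 := getD_add_one_le hpos h (by rw [hlen]; exact (reduces_stepIndex hP hv').lt_length)
  linarith

/-- After the step of smallest possible label, all labels are at least as large. -/
theorem modifiedEdgeLabel_le_next (hP : IsRootedForest P) {prev : Option (Word P)} {pos : List ℕ}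
    {x y y₁ y₂ : Word P} (hpos : pos.Pairwise (· < ·)) (hlen : pos.length = y.letters.length)
    (h₁ : y₁ ⋖ y) (h₂ : y₂ ⋖ y₁) (hx : x ≤ y₂)
    (hmin : ∀ z, x ≤ z → z ⋖ y → stepIndex y y₁ ≤ stepIndex y z) :
    modifiedEdgeLabel prev pos y y₁ ≤
      modifiedEdgeLabel (some y) (stepPositions pos y y₁) y₁ y₂ := by
  have r₁ := reduces_stepIndex hP h₁
  have r₂ := reduces_stepIndex hP h₂
  have hmin' : ∀ i z, Reduces y.letters i z → y₂.letters ≼ z → stepIndex y y₁ ≤ i := by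
    intro i z hz hyz
    refine (hmin ⟨z⟩ (hx.trans ((Word.le_iff _ _).2 hyz)) (hz.covBy hP)).trans ?_
    exact hz.stepIndex.1
  have hge : stepIndex y y₁ ≤ stepIndex y₁ y₂ := by
    by_contra! hlt
    obtain ⟨z, hz, hyz⟩ := r₁.exists_of_lt r₂ hlt
    exact (hmin' _ z hz hyz).not_gt hlt
  refine (modifiedEdgeLabel_le prev pos y y₁).trans ?_
  have hlt := r₂.lt_length
  by_cases hl : y₁.letters.length = y.letters.length
  · -- a modified step would delete a letter `a` that was the second of two letters `b`, and then the
    -- first `b` could have been lowered instead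
    have hnot : ¬ ∃ x, some y = some x ∧ IsModifiedStep x y₁ y₂ := by
      rintro ⟨_, ⟨rfl⟩, h1, h2, h3, h4, b, -, h6, h7⟩
      rw [h3] at r₂
      obtain ⟨z, hz, hyz⟩ := r₁.exists_of_double hl r₂ h2 h4 h6 h7
      have := hmin' _ z hz hyz
      omega
    rw [modifiedEdgeLabel, if_neg hnot, stepPositions, if_pos hl]
    rcases hge.eq_or_lt with he | hlt'
    · rw [← he]
    · have := getD_add_one_le hpos hlt' (by omega)
      linarith
  · have hnot : ¬ ∃ x, some y = some x ∧ IsModifiedStep x y₁ y₂ := by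
      rintro ⟨_, ⟨rfl⟩, h1, -⟩
      exact hl h1
    rw [modifiedEdgeLabel, if_neg hnot, stepPositions, if_neg hl]
    have h4 : (pos.eraseIdx (stepIndex y y₁)).getD (stepIndex y₁ y₂) 0 =
        pos.getD (stepIndex y₁ y₂ + 1) 0 := by
      simp [List.getD_eq_getElem?_getD, List.getElem?_eraseIdx, hge.not_gt]
    rw [h4]
    have := getD_add_one_le hpos (Nat.lt_succ_of_le hge) (by have := r₁.length_or; omega)
    linarith

/-- A letter that is neither minimal nor above a chain of two letters has rank `2` in the poset with
a bottom element adjoined. -/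
theorem height_coe_eq_two {a b : P} (hab : a < b) (h : ¬ ∃ a₁ a₂ : P, a₁ < a₂ ∧ a₂ < b) :
    Order.height (b : WithBot P) = 2 := by
  have hbot : Order.height (⊥ : WithBot P) = 0 := Order.height_bot _
  apply le_antisymm
  · rw [show (2 : ℕ∞) = ((2 : ℕ) : ℕ∞) from rfl, Order.height_le_coe_iff]
    intro y hy
    induction y with
    | bot => rw [hbot]; norm_num
    | coe a₂ =>
      refine lt_of_le_of_lt (b := ((1 : ℕ) : ℕ∞)) ?_ (by norm_num)
      rw [Order.height_le_coe_iff]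
      intro z hz
      induction z with
      | bot => rw [hbot]; norm_num
      | coe a₁ => exact absurd ⟨a₁, a₂, WithBot.coe_lt_coe.1 hz, WithBot.coe_lt_coe.1 hy⟩ h
  · have h1 := Order.height_add_one_le (WithBot.bot_lt_coe a)
    have h2 := Order.height_add_one_le (WithBot.coe_lt_coe.2 hab)
    rw [hbot] at h1
    calc (2 : ℕ∞) = 0 + 1 + 1 := by norm_num
      _ ≤ Order.height (a : WithBot P) + 1 := by gcongr
      _ ≤ _ := h2

/-- The words `x ≤ y` admit no words `αbβ ≥ x` and `αbbβ ≤ y` with a letter `b` of rank at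
least `3`. -/
def NoHighDouble (x y : Word P) : Prop :=
  ∀ (α β : List P) (b : P), x ≤ ⟨α ++ b :: β⟩ → (⟨α ++ b :: b :: β⟩ : Word P) ≤ y →
    ¬ ∃ a₁ a₂ : P, a₁ < a₂ ∧ a₂ < b

/-- A step whose label is not the smallest possible one can be followed by a step with a smaller
label. -/
theorem exists_modifiedEdgeLabel_lt (hP : IsRootedForest P) {prev : Option (Word P)} {pos : List ℕ}
    {x y y₁ z : Word P} (hpos : pos.Pairwise (· < ·)) (hlen : pos.length = y.letters.length)
    (hxy : NoHighDouble x y) (h₁ : y₁ ⋖ y) (hx : x ≤ y₁) (hz : z ⋖ y) (hxz : x ≤ z)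
    (hlt : stepIndex y z < stepIndex y y₁) :
    ∃ y₂, y₂ ⋖ y₁ ∧ x ≤ y₂ ∧ modifiedEdgeLabel (some y) (stepPositions pos y y₁) y₁ y₂ <
      modifiedEdgeLabel prev pos y y₁ := by
  have r₁ := reduces_stepIndex hP h₁
  have rz := reduces_stepIndex hP hz
  rcases r₁.exists_lt_or_double hP ((Word.le_iff _ _).1 hx) rz ((Word.le_iff _ _).1 hxz) hlt with
    ⟨i, hi, v, hv, hxv⟩ | ⟨α, b, β, hy, hj, hxα⟩
  · refine ⟨⟨v⟩, hv.covBy hP, (Word.le_iff _ _).2 hxv, ?_⟩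
    have h1 := modifiedEdgeLabel_le (some y) (stepPositions pos y y₁) y₁ ⟨v⟩
    have h2 := sub_half_le_modifiedEdgeLabel prev pos y y₁
    have h3 : stepIndex y₁ ⟨v⟩ < stepIndex y y₁ := hv.stepIndex.1.trans_lt hi
    rw [getD_stepPositions_of_lt pos h3] at h1
    have h4 := getD_add_one_le hpos h3 (by rw [hlen]; exact r₁.lt_length)
    linarith
  · -- the doubled letter `b`, at `j - 1` and `j`, has rank `1` or `2`
    have hb := hxy α β b ((Word.le_iff _ _).2 hxα) (by rw [← hy])
    obtain ⟨y⟩ := y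
    obtain ⟨y₁⟩ := y₁
    simp only at hy hlen r₁
    subst hy
    by_cases hbm : IsMin b
    · -- a minimal `b` at `j` is not the leftmost one of its run
      exfalso
      have h2 : Reduces (α ++ b :: b :: β) (α.length + 1) (α ++ b :: β) :=
        Reduces.append α (.cons (.delete hbm))
      have h3 : Reduces (α ++ b :: b :: β) (α.length + 0) (α ++ b :: β) :=
        Reduces.append α (.delete hbm)
      rw [hj] at r₁
      obtain rfl := r₁.unique hP h2
      have := h3.stepIndex.1
      omega
    · -- a `b` of rank `2` has been lowered, and its deletion is a modified step
      obtain ⟨a, hab⟩ := hP.exists_covBy hbm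
      have ha : IsMin a := by
        by_contra ha
        obtain ⟨c, hc⟩ := not_isMin_iff.1 ha
        exact hb ⟨c, a, hc, hab.lt⟩
      have h2 : Reduces (α ++ b :: b :: β) (α.length + 1) (α ++ b :: a :: β) :=
        Reduces.append α (.cons (.lower hab))
      rw [hj] at r₁
      obtain rfl := r₁.unique hP h2
      have h3 : Reduces (α ++ b :: a :: β) (α.length + 1) (α ++ b :: β) :=
        Reduces.append α (.cons (.delete ha))
      have hl : (α ++ b :: a :: β).length = (α ++ b :: b :: β).length := by simp
      have hs : stepIndex ⟨α ++ b :: a :: β⟩ ⟨α ++ b :: β⟩ = α.length + 1 := by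
        refine le_antisymm h3.stepIndex.1 ?_
        by_contra! hlt'
        obtain ⟨h4, -⟩ := h3.stepIndex.2.eraseIdx_eq (by simp)
        have h5 := congrArg (fun l => l[α.length]?) h4
        rw [List.getElem?_eraseIdx] at h5
        split_ifs at h5 with h6
        · omega
        · simp at h5
          exact hab.lt.ne h5
      refine ⟨⟨α ++ b :: β⟩, h3.covBy hP, (Word.le_iff _ _).2 hxα, ?_⟩
      have hmod : IsModifiedStep (⟨α ++ b :: b :: β⟩ : Word P) ⟨α ++ b :: a :: β⟩ ⟨α ++ b :: β⟩ := by
        refine ⟨hl, by simp, hs.trans hj.symm, by omega, b, height_coe_eq_two hab.lt hb, ?_, ?_⟩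
        · rw [hj]; simp
        · rw [hj]; simp
      have hnot : ¬ ∃ x, prev = some x ∧
          IsModifiedStep x (⟨α ++ b :: b :: β⟩ : Word P) ⟨α ++ b :: a :: β⟩ := by
        rintro ⟨x, -, -, h5, -⟩
        simp at h5
      rw [modifiedEdgeLabel, if_pos ⟨_, rfl, hmod⟩, modifiedEdgeLabel, if_neg hnot, stepPositions,
        if_pos hl, hs, hj]
      linarith

end Steps

/-! ### The modified position labeling is a dual CL-labeling -/

section DualCL

variable {P : Type*} [PartialOrder P]

open OrderDual

theorem NoHighDouble.mono {x x' y y' : Word P} (h : NoHighDouble x y) (hx : x ≤ x')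
    (hy : y' ≤ y) : NoHighDouble x' y' :=
  fun α β b h1 h2 => h α β b (hx.trans h1) (h2.trans hy)

theorem exists_covBy_of_lt (hP : IsRootedForest P) {x y : Word P} (h : x < y) :
    ∃ z, z ⋖ y ∧ x ≤ z := by
  obtain ⟨i, z, hz, hxz⟩ := exists_reduces_of_subword hP ((Word.le_iff _ _).1 h.le)
    (fun he => h.ne (Word.ext he))
  exact ⟨⟨z⟩, hz.covBy hP, (Word.le_iff _ _).2 hxz⟩

theorem covBy_eq_of_stepIndex_eq (hP : IsRootedForest P) {y v v' : Word P} (h : v ⋖ y)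
    (h' : v' ⋖ y) (he : stepIndex y v = stepIndex y v') : v = v' := by
  have h1 := reduces_stepIndex hP h
  rw [he] at h1
  exact Word.ext (h1.unique hP (reduces_stepIndex hP h'))

/-- The increasing chain of a rooted interval with top element `y` and bottom element `x`. The root
enters through the positions `pos` of the letters of `y` and the element `prev` that precedes `y`.
The chain makes the step of smallest label and goes on in the same way. -/
theorem exists_increasing_chain (hP : IsRootedForest P) (x y : Word P) (prev : Option (Word P))
    (pos : List ℕ) (hxy : x ≤ y) (hd : NoHighDouble x y) (hpos : pos.Pairwise (· < ·))
    (hlen : pos.length = y.letters.length) :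
    ∃ c : List (Word P)ᵒᵈ, IsSaturatedChain (toDual y) (toDual x) c ∧
      (modifiedEdgeLabels prev pos (c.map ofDual)).IsChain (· ≤ ·) ∧
      ∀ c' : List (Word P)ᵒᵈ, IsSaturatedChain (toDual y) (toDual x) c' → c' ≠ c →
        ¬ (modifiedEdgeLabels prev pos (c'.map ofDual)).IsChain (· ≤ ·) ∧
        List.Lex (· < ·) (modifiedEdgeLabels prev pos (c.map ofDual))
          (modifiedEdgeLabels prev pos (c'.map ofDual)) := by
  induction hn : wordRank y.letters using Nat.strong_induction_on generalizing y prev pos with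
  | _ n ih =>
    subst hn
    rcases hxy.eq_or_lt with rfl | hlt
    · refine ⟨[toDual x], isSaturatedChain_singleton _, by simp [modifiedEdgeLabels], ?_⟩
      intro c' hc' hne
      exact absurd (isSaturatedChain_self_iff.1 hc') hne
    -- the induction hypothesis, for the elements covered by `y`
    have IH : ∀ y₁, y₁ ⋖ y → x ≤ y₁ → ∃ c : List (Word P)ᵒᵈ,
        IsSaturatedChain (toDual y₁) (toDual x) c ∧
        (modifiedEdgeLabels (some y) (stepPositions pos y y₁) (c.map ofDual)).IsChain (· ≤ ·) ∧
        ∀ c' : List (Word P)ᵒᵈ, IsSaturatedChain (toDual y₁) (toDual x) c' → c' ≠ c →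
          ¬ (modifiedEdgeLabels (some y) (stepPositions pos y y₁)
            (c'.map ofDual)).IsChain (· ≤ ·) ∧
          List.Lex (· < ·) (modifiedEdgeLabels (some y) (stepPositions pos y y₁) (c.map ofDual))
            (modifiedEdgeLabels (some y) (stepPositions pos y y₁) (c'.map ofDual)) := by
      intro y₁ h₁ hx₁
      refine ih _ ?_ y₁ (some y) (stepPositions pos y y₁) hx₁ (hd.mono le_rfl h₁.le)
        (pairwise_stepPositions _ _ hpos) (length_stepPositions hP h₁ hlen) rfl
      have := (reduces_stepIndex hP h₁).wordRank_add_one hP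
      omega
    -- the step of smallest index
    obtain ⟨z, hz, hxz⟩ := exists_covBy_of_lt hP hlt
    obtain ⟨y₁, ⟨h₁, hx₁⟩, hmin⟩ := exists_minimalFor_of_wellFoundedLT
      (fun z => z ⋖ y ∧ x ≤ z) (stepIndex y) ⟨z, hz, hxz⟩
    have hmin' : ∀ z, x ≤ z → z ⋖ y → stepIndex y y₁ ≤ stepIndex y z := by
      intro z hxz hz
      by_contra! hcon
      exact (hmin ⟨hz, hxz⟩ hcon.le).not_gt hcon
    obtain ⟨c₁, hc₁, hinc, huniq⟩ := IH y₁ h₁ hx₁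
    obtain ⟨l₁, rfl⟩ := hc₁.exists_eq_cons
    refine ⟨toDual y :: toDual y₁ :: l₁, ?_, ?_, ?_⟩
    · exact isSaturatedChain_cons_cons.2 ⟨rfl, h₁.toDual, hc₁⟩
    · simp only [List.map_cons, ofDual_toDual, modifiedEdgeLabels] at hinc ⊢
      cases l₁ with
      | nil => simp [modifiedEdgeLabels]
      | cons y₂ l₂ =>
        obtain ⟨-, h₂, hc₂⟩ := isSaturatedChain_cons_cons.1 hc₁
        simp only [List.map_cons, modifiedEdgeLabels] at hinc ⊢
        exact List.isChain_cons_cons.2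
          ⟨modifiedEdgeLabel_le_next hP hpos hlen h₁ h₂.ofDual hc₂.le hmin', hinc⟩
    · intro c' hc' hne
      obtain ⟨l', rfl⟩ := hc'.exists_eq_cons
      cases l' with
      | nil => exact absurd (isSaturatedChain_singleton_iff.1 hc').2 hlt.ne'
      | cons y' l' =>
      obtain ⟨-, h', hc''⟩ := isSaturatedChain_cons_cons.1 hc'
      have h'y : ofDual y' ⋖ y := h'.ofDual
      have hxy' : x ≤ ofDual y' := hc''.le
      simp only [List.map_cons, ofDual_toDual, modifiedEdgeLabels]
      by_cases hyy : y' = toDual y₁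
      · subst hyy
        obtain ⟨k1, k2⟩ := huniq _ hc'' (fun h => hne (by rw [h]))
        exact ⟨fun h => k1 h.tail, List.Lex.cons k2⟩
      · have hidx : stepIndex y y₁ < stepIndex y (ofDual y') :=
          lt_of_le_of_ne (hmin' _ hxy' h'y)
            (fun he => hyy (covBy_eq_of_stepIndex_eq hP h₁ h'y he).symm)
        refine ⟨fun hchain => ?_, List.Lex.rel (modifiedEdgeLabel_lt hP hpos hlen h'y hidx)⟩
        obtain ⟨c₃, hc₃, -, huniq'⟩ := IH (ofDual y') h'y hxy'
        -- an increasing continuation is the lexicographically first one, so it starts with the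
        -- smallest label, which is smaller than the label of the first step
        have heq : y' :: l' = c₃ := by
          by_contra hne'
          exact (huniq' _ hc'' hne').1 hchain.tail
        obtain ⟨y₂, h₂, hxy₂, hlt₂⟩ := exists_modifiedEdgeLabel_lt (prev := prev) hP hpos hlen hd
          h'y hxy' h₁ hx₁ hidx
        obtain ⟨c₄, hc₄, -⟩ := ih (wordRank y₂.letters) (by
            have e1 := (reduces_stepIndex hP h'y).wordRank_add_one hP
            have e2 := (reduces_stepIndex hP h₂).wordRank_add_one hP
            omega)
          y₂ (some (ofDual y')) (stepPositions (stepPositions pos y (ofDual y')) (ofDual y') y₂)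
          hxy₂ (hd.mono le_rfl (h₂.le.trans h'y.le))
          (pairwise_stepPositions _ _ (pairwise_stepPositions _ _ hpos))
          (length_stepPositions hP h₂ (length_stepPositions hP h'y hlen)) rfl
        obtain ⟨l₄, rfl⟩ := hc₄.exists_eq_cons
        have hc₅ : IsSaturatedChain y' (toDual x) (y' :: toDual y₂ :: l₄) :=
          isSaturatedChain_cons_cons.2 ⟨rfl, h₂.toDual, hc₄⟩
        subst heq
        cases l' with
        | nil =>
          obtain rfl := (isSaturatedChain_singleton_iff.1 hc'').2
          exact (h₂.lt.trans_le hxy₂).false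
        | cons y₃ l₃ =>
          simp only [List.map_cons, modifiedEdgeLabels] at hchain
          have hle := (List.isChain_cons_cons.1 hchain).1
          by_cases hcc : y' :: toDual y₂ :: l₄ = y' :: y₃ :: l₃
          · simp only [List.cons.injEq, true_and] at hcc
            rw [← hcc.1] at hle
            exact hle.not_gt hlt₂
          · have hlex := (huniq' _ hc₅ hcc).2
            simp only [List.map_cons, modifiedEdgeLabels, ofDual_toDual] at hlex
            rcases List.cons_lex_cons_iff.1 hlex with h | ⟨h, -⟩
            · exact (hle.trans_lt h).not_gt hlt₂
            · exact (hle.trans_eq h).not_gt hlt₂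

/-- The positions in `w` of the letters of the last element of a chain, if `pos` lists those of its
first element. -/
noncomputable def endPositions {P : Type*} : List ℕ → List (Word P) → List ℕ
  | pos, v' :: v :: c => endPositions (stepPositions pos v' v) (v :: c)
  | pos, _ => pos

theorem endPositions_concat {P : Type*} (pos : List ℕ) (r : List (Word P)) (y v : Word P) :
    endPositions pos (r ++ [y, v]) = stepPositions (endPositions pos (r ++ [y])) y v := by
  induction r generalizing pos with
  | nil => simp [endPositions]
  | cons a r ih =>
    cases r with
    | nil => simp [endPositions]
    | cons b r => simpa [endPositions] using ih (stepPositions pos a b)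

theorem getLast?_modifiedEdgeLabels (prev : Option (Word P)) (pos : List ℕ) (r : List (Word P))
    (y v : Word P) :
    (modifiedEdgeLabels prev pos (r ++ [y, v])).getLast? =
      some (modifiedEdgeLabel (r.getLast?.or prev) (endPositions pos (r ++ [y])) y v) := by
  induction r generalizing prev pos with
  | nil => simp [endPositions, modifiedEdgeLabels]
  | cons a r ih =>
    cases r with
    | nil => simp [endPositions, modifiedEdgeLabels]
    | cons b r =>
      have := ih (some a) (stepPositions pos a b)
      simp only [List.cons_append, modifiedEdgeLabels, List.getLast?_cons, endPositions] at this ⊢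
      rw [this]
      simp

/-- The labels of a chain relative to a root depend only on the end positions of the root and on
the last but one element of the root. -/
theorem rootedLabels_modifiedPositionLabeling (w : Word P) (r c : List (Word P)) (y : Word P) :
    rootedLabels (modifiedPositionLabeling w) (r ++ [y]) c =
      modifiedEdgeLabels r.getLast?
        (endPositions (List.range' 1 w.letters.length) (r ++ [y])) (y :: c) := by
  induction c generalizing r y with
  | nil => simp [rootedLabels, modifiedEdgeLabels]
  | cons v c ih =>
    rw [rootedLabels, modifiedEdgeLabels, ih (r ++ [y]) v]
    congr 1
    · rw [modifiedPositionLabeling, List.append_assoc, List.singleton_append,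
        getLast?_modifiedEdgeLabels]
      simp
    · rw [List.append_assoc, List.singleton_append, endPositions_concat]
      simp

theorem rootedLabels_map_ofDual {Q Λ : Type*} (f : List Q → Λ) (r c : List Qᵒᵈ) :
    rootedLabels (fun c : List Qᵒᵈ => f (c.map ofDual)) r c =
      rootedLabels f (r.map ofDual) (c.map ofDual) := by
  induction c generalizing r with
  | nil => rfl
  | cons v c ih =>
    rw [rootedLabels, ih, List.map_append, List.map_cons, List.map_cons, List.map_nil, rootedLabels]

theorem endPositions_spec (hP : IsRootedForest P) {w y : Word P} {r : List (Word P)ᵒᵈ}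
    (hr : IsSaturatedChain (toDual w) (toDual y) r) {pos : List ℕ} (hpos : pos.Pairwise (· < ·))
    (hlen : pos.length = w.letters.length) :
    (endPositions pos (r.map ofDual)).Pairwise (· < ·) ∧
      (endPositions pos (r.map ofDual)).length = y.letters.length := by
  induction r generalizing w pos with
  | nil => simp [IsSaturatedChain] at hr
  | cons a r ih =>
    cases r with
    | nil =>
      rw [isSaturatedChain_singleton_iff] at hr
      obtain rfl : w = y := hr.2
      exact ⟨hpos, hlen⟩
    | cons b r =>
      obtain ⟨rfl, h1, h2⟩ := isSaturatedChain_cons_cons.1 hr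
      exact ih (w := ofDual b) h2 (pairwise_stepPositions _ _ hpos)
        (length_stepPositions hP h1.ofDual hlen)

theorem isDualCLLabeling_modifiedPositionLabeling (hP : IsRootedForest P) {u w : Word P}
    (hd : NoHighDouble u w) : IsDualCLLabeling u w (modifiedPositionLabeling w) := by
  intro y x r hr hyx hxu
  obtain ⟨y, rfl⟩ := toDual.surjective y
  obtain ⟨x, rfl⟩ := toDual.surjective x
  have hxy : x ≤ y := hyx
  have hux : u ≤ x := hxu
  have hyw : y ≤ w := hr.le
  obtain ⟨r', rfl⟩ := List.getLast?_eq_some_iff.1 hr.2.2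
  obtain ⟨h1, h2⟩ := endPositions_spec hP hr (pos := List.range' 1 w.letters.length)
    (List.pairwise_lt_range' ..) (by simp)
  have key : ∀ c, IsSaturatedChain (toDual y) (toDual x) c →
      rootedLabels (fun c : List (Word P)ᵒᵈ => modifiedPositionLabeling w (c.map ofDual))
        (r' ++ [toDual y]) c.tail = modifiedEdgeLabels (r'.map ofDual).getLast?
        (endPositions (List.range' 1 w.letters.length) ((r' ++ [toDual y]).map ofDual))
        (c.map ofDual) := by
    intro c hc
    obtain ⟨l, rfl⟩ := hc.exists_eq_cons
    rw [rootedLabels_map_ofDual, List.map_append, List.map_cons, List.map_nil,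
      rootedLabels_modifiedPositionLabeling]
    rfl
  obtain ⟨c, hc, hinc, huniq⟩ := exists_increasing_chain hP x y (r'.map ofDual).getLast? _ hxy
    (hd.mono hux hyw) h1 h2
  refine ⟨c, hc, by rw [key c hc]; exact hinc, fun c' hc' hne => ?_⟩
  rw [key c hc, key c' hc']
  exact huniq c' hc' hne

/-! ### Intervals of words -/

theorem finite_Iic_word (hP : IsRootedForest P) (w : Word P) : (Set.Iic w).Finite := by
  induction hn : wordRank w.letters using Nat.strong_induction_on generalizing w with
  | _ n ih =>
    subst hn
    have hsub : Set.Iic w ⊆ {w} ∪ ⋃ i ∈ Finset.range w.letters.length,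
        ⋃ z ∈ {z | Reduces w.letters i z}, Set.Iic (⟨z⟩ : Word P) := by
      intro v hv
      rcases (Set.mem_Iic.1 hv).eq_or_lt with rfl | hlt
      · exact Or.inl rfl
      · obtain ⟨z, hz, hvz⟩ := exists_covBy_of_lt hP hlt
        have := reduces_stepIndex hP hz
        right
        simp only [Set.mem_iUnion, Finset.mem_range]
        exact ⟨_, this.lt_length, _, this, hvz⟩
    refine ((Set.finite_singleton w).union ?_).subset hsub
    refine Set.Finite.biUnion (Finset.finite_toSet _) fun i _ => Set.Finite.biUnion ?_ ?_
    · exact Set.Subsingleton.finite fun z hz z' hz' => Reduces.unique hP hz hz'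
    · intro z hz
      refine ih _ ?_ _ rfl
      have := Reduces.wordRank_add_one hP hz
      simp only
      omega

theorem length_eq_of_isSaturatedChain (hP : IsRootedForest P) {w u : (Word P)ᵒᵈ}
    {c : List (Word P)ᵒᵈ} (h : IsSaturatedChain w u c) :
    c.length + wordRank (ofDual u).letters = wordRank (ofDual w).letters + 1 := by
  induction c generalizing w with
  | nil => simp [IsSaturatedChain] at h
  | cons a c ih =>
    cases c with
    | nil =>
      obtain ⟨-, rfl⟩ := isSaturatedChain_singleton_iff.1 h
      simp [add_comm]
    | cons b c =>
      obtain ⟨rfl, h1, h2⟩ := isSaturatedChain_cons_cons.1 h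
      have h3 := ih h2
      have h4 := (reduces_stepIndex hP h1.ofDual).wordRank_add_one hP
      simp only [List.length_cons] at h3 ⊢
      omega

theorem dualCL_of_not_hasNontrivialDisconnectedSubinterval (hP : IsRootedForest P) {u w : Word P}
    (huw : u ≤ w) (h : ¬ HasNontrivialDisconnectedSubinterval u w) :
    IsDualCLLabeling u w (modifiedPositionLabeling w) ∧ IsDualCLShellable u w ∧
      IsShellableInterval u w := by
  have hd : NoHighDouble u w := by
    rintro α β b h1 h2 ⟨a₁, a₂, h3, h4⟩
    exact h (hasNontrivialDisconnectedSubinterval_of_double h3 h4 h1 h2)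
  have hlab := isDualCLLabeling_modifiedPositionLabeling hP hd
  have hgr : ∀ (x y : (Word P)ᵒᵈ) (c c' : List (Word P)ᵒᵈ), IsSaturatedChain x y c →
      IsSaturatedChain x y c' → c.length = c'.length := by
    intro x y c c' hc hc'
    have h1 := length_eq_of_isSaturatedChain hP hc
    have h2 := length_eq_of_isSaturatedChain hP hc'
    omega
  have hfin : (Set.Icc (toDual w) (toDual u)).Finite :=
    (finite_Iic_word hP w).subset fun v hv => hv.1
  exact ⟨hlab, ⟨hfin, hgr _ _, ℚ, inferInstance, _, hlab⟩,
    (isShellableInterval_of_isCLLabeling (b := toDual w) (t := toDual u)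
      (toDual_le_toDual.2 huw) hfin hgr hlab).of_dual⟩

end DualCL

/-! ### Permutations given by two linear orders on a finite set -/

section Realizations

open OrderDual

/-- The permutation `π` is the isomorphism type of a set `X` with two linear orders, which are given
by keys: `k₁` orders the positions and `k₂` the letters. -/
def Permutation.IsRealizedBy (π : Permutation) {X A B : Type*} [LT A] [LT B]
    (e : Fin π.length ≃ X) (k₁ : X → A) (k₂ : X → B) : Prop :=
  (∀ i j, i < j ↔ k₁ (e i) < k₁ (e j)) ∧
    ∀ i j, π.toPerm i < π.toPerm j ↔ k₂ (e i) < k₂ (e j)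

theorem exists_equiv_fin_lt_iff {X A : Type*} [Fintype X] [LinearOrder A] {k : X → A}
    (h : k.Injective) : ∃ e : Fin (Fintype.card X) ≃ X, ∀ i j, i < j ↔ k (e i) < k (e j) := by
  let _ := LinearOrder.lift' k h
  let e : Fin (Fintype.card X) ≃o X := Fintype.orderIsoFinOfCardEq X rfl
  exact ⟨e.toEquiv, fun i j => e.lt_iff_lt.symm⟩

theorem exists_permutation_isRealizedBy {X A B : Type*} [Fintype X] [LinearOrder A] [LinearOrder B]
    {k₁ : X → A} {k₂ : X → B} (h₁ : k₁.Injective) (h₂ : k₂.Injective) :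
    ∃ (π : Permutation) (e : Fin π.length ≃ X), π.IsRealizedBy e k₁ k₂ := by
  obtain ⟨e₁, he₁⟩ := exists_equiv_fin_lt_iff h₁
  obtain ⟨e₂, he₂⟩ := exists_equiv_fin_lt_iff h₂
  exact ⟨⟨_, e₁.trans e₂.symm⟩, e₁, he₁, fun i j => by simp [he₂]⟩

theorem Permutation.isRealizedBy_self (π : Permutation) :
    π.IsRealizedBy (Equiv.refl _) id π.toPerm :=
  ⟨fun _ _ => Iff.rfl, fun _ _ => Iff.rfl⟩

variable {σ τ : Permutation} {X Y A B C D : Type*} [LT A] [LT B] [LT C] [LT D]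
  {e : Fin σ.length ≃ X} {e' : Fin τ.length ≃ Y} {k₁ : X → A} {k₂ : X → B} {l₁ : Y → C} {l₂ : Y → D}

theorem Permutation.IsRealizedBy.le (hσ : σ.IsRealizedBy e k₁ k₂) (hτ : τ.IsRealizedBy e' l₁ l₂)
    (f : X → Y) (h₁ : ∀ x y, k₁ x < k₁ y → l₁ (f x) < l₁ (f y))
    (h₂ : ∀ x y, k₂ x < k₂ y → l₂ (f x) < l₂ (f y)) : σ ≤ τ := by
  have hmono : StrictMono fun i => e'.symm (f (e i)) := fun i j hij => by
    rw [hτ.1]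
    simpa using h₁ _ _ ((hσ.1 i j).1 hij)
  refine ⟨OrderEmbedding.ofStrictMono _ hmono, fun i j => ?_⟩
  have key : ∀ i j, σ.toPerm i < σ.toPerm j →
      τ.toPerm (e'.symm (f (e i))) < τ.toPerm (e'.symm (f (e j))) := fun i j hij => by
    rw [hτ.2]
    simpa using h₂ _ _ ((hσ.2 i j).1 hij)
  refine ⟨key i j, fun h => ?_⟩
  by_contra hcon
  rcases (not_lt.1 hcon).eq_or_lt with he | hlt
  · obtain rfl := σ.toPerm.injective he
    exact lt_irrefl _ h
  · exact lt_asymm h (key j i hlt)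

theorem Permutation.IsRealizedBy.exists_map (hσ : σ.IsRealizedBy e k₁ k₂)
    (hτ : τ.IsRealizedBy e' l₁ l₂) (h : σ ≤ τ) :
    ∃ f : X → Y, (∀ x y, k₁ x < k₁ y → l₁ (f x) < l₁ (f y)) ∧
      ∀ x y, k₂ x < k₂ y → l₂ (f x) < l₂ (f y) := by
  obtain ⟨f, hf⟩ := h
  refine ⟨fun x => e' (f (e.symm x)), fun x y hxy => ?_, fun x y hxy => ?_⟩
  · rw [← hτ.1, f.lt_iff_lt, hσ.1]
    simpa using hxy
  · rw [← hτ.2, ← hf, hσ.2]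
    simpa using hxy

theorem Permutation.eq_of_le_of_length_eq {σ τ : Permutation} (h : σ ≤ τ)
    (hl : σ.length = τ.length) : σ = τ := by
  refine le_antisymm h ?_
  obtain ⟨n, σ⟩ := σ
  obtain ⟨m, τ⟩ := τ
  obtain rfl : n = m := hl
  obtain ⟨f, hf⟩ := h
  have hid : ∀ i, f i = i := fun i => by
    have hbij : Function.Surjective f := Finite.surjective_of_injective f.injective
    have : RelIso.ofSurjective f hbij = OrderIso.refl (Fin n) := Subsingleton.elim _ _
    exact congrArg (fun e : Fin n ≃o Fin n => e i) this
  refine ⟨RelEmbedding.refl _, fun i j => ?_⟩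
  have := hf i j
  simp only [hid] at this
  exact this.symm

end Realizations

/-! ### The layered permutation with given sizes of layers -/

section Layered

open OrderDual

/-- The points of the layered permutation whose `i`-th layer has `w(i) + 1` elements. -/
abbrev LayerPoint (w : Word ℕ) : Type :=
  Σ i : Fin w.letters.length, Fin (w.letters.get i + 1)

/-- The key for the positions: the layers follow each other from left to right. -/
def LayerPoint.posKey {w : Word ℕ} (x : LayerPoint w) : ℕ ×ₗ ℕ :=
  toLex (x.1.val, x.2.val)

/-- The key for the letters: the letters increase from layer to layer, and decrease in
each layer. -/
def LayerPoint.valKey {w : Word ℕ} (x : LayerPoint w) : ℕ ×ₗ ℕᵒᵈ :=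
  toLex (x.1.val, toDual x.2.val)

theorem LayerPoint.posKey_lt_iff {w : Word ℕ} {x y : LayerPoint w} :
    x.posKey < y.posKey ↔ x.1 < y.1 ∨ x.1 = y.1 ∧ x.2.val < y.2.val := by
  simp [posKey, Prod.Lex.toLex_lt_toLex, Fin.ext_iff]

theorem LayerPoint.valKey_lt_iff {w : Word ℕ} {x y : LayerPoint w} :
    x.valKey < y.valKey ↔ x.1 < y.1 ∨ x.1 = y.1 ∧ y.2.val < x.2.val := by
  simp [valKey, Prod.Lex.toLex_lt_toLex, Fin.ext_iff]

theorem LayerPoint.posKey_injective (w : Word ℕ) :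
    (LayerPoint.posKey : LayerPoint w → _).Injective := by
  rintro ⟨i, a⟩ ⟨j, b⟩ h
  simp only [posKey, EmbeddingLike.apply_eq_iff_eq, Prod.mk.injEq] at h
  obtain rfl := Fin.ext h.1
  obtain rfl := Fin.ext h.2
  rfl

theorem LayerPoint.valKey_injective (w : Word ℕ) :
    (LayerPoint.valKey : LayerPoint w → _).Injective := by
  rintro ⟨i, a⟩ ⟨j, b⟩ h
  simp only [valKey, EmbeddingLike.apply_eq_iff_eq, Prod.mk.injEq] at h
  obtain rfl := Fin.ext h.1
  obtain rfl := Fin.ext h.2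
  rfl

theorem exists_layeredPerm (w : Word ℕ) : ∃ (π : Permutation) (e : Fin π.length ≃ LayerPoint w),
    π.IsRealizedBy e LayerPoint.posKey LayerPoint.valKey :=
  exists_permutation_isRealizedBy (LayerPoint.posKey_injective w) (LayerPoint.valKey_injective w)

/-- The layered permutation whose `i`-th layer has `w(i) + 1` elements. -/
noncomputable def layeredPerm (w : Word ℕ) : Permutation :=
  (exists_layeredPerm w).choose

theorem layeredPerm_spec (w : Word ℕ) : ∃ e : Fin (layeredPerm w).length ≃ LayerPoint w,
    (layeredPerm w).IsRealizedBy e LayerPoint.posKey LayerPoint.valKey :=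
  (exists_layeredPerm w).choose_spec

theorem word_le_iff_exists_strictMono {u w : Word ℕ} :
    u ≤ w ↔ ∃ g : Fin u.letters.length → Fin w.letters.length, StrictMono g ∧
      ∀ i, u.letters.get i ≤ w.letters.get (g i) := by
  constructor
  · rintro ⟨l, h1, h2⟩
    obtain ⟨f, hf⟩ := List.sublist_iff_exists_fin_orderEmbedding_get_eq.1 h1
    obtain ⟨hl, h2⟩ := List.forall₂_iff_get.1 h2
    refine ⟨fun i => f (Fin.cast hl i), fun i j hij => f.strictMono hij, fun i => ?_⟩
    rw [← hf]
    exact h2 i i.2 _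
  · rintro ⟨g, hg, h⟩
    refine ⟨List.ofFn fun i => w.letters.get (g i), ?_, ?_⟩
    · rw [List.sublist_iff_exists_fin_orderEmbedding_get_eq]
      refine ⟨OrderEmbedding.ofStrictMono (fun i => g (Fin.cast List.length_ofFn i))
        (fun i j hij => hg hij), fun i => ?_⟩
      rw [List.get_ofFn]
      rfl
    · rw [List.forall₂_iff_get]
      refine ⟨by simp, fun i h1 h2 => ?_⟩
      simpa using h ⟨i, h1⟩

/-- Pattern containment of layered permutations is generalized subword order on the words of
their layer sizes. -/
theorem layeredPerm_le_iff {u w : Word ℕ} : layeredPerm u ≤ layeredPerm w ↔ u ≤ w := by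
  obtain ⟨e, he⟩ := layeredPerm_spec u
  obtain ⟨e', he'⟩ := layeredPerm_spec w
  rw [word_le_iff_exists_strictMono]
  constructor
  · intro h
    obtain ⟨f, hf₁, hf₂⟩ := he.exists_map he' h
    simp only [LayerPoint.posKey_lt_iff, LayerPoint.valKey_lt_iff] at hf₁ hf₂
    have hlt : ∀ x y : LayerPoint u, x.1 < y.1 → (f x).1 < (f y).1 := by
      intro x y hxy
      have h1 := hf₁ x y (Or.inl hxy)
      have h2 := hf₂ x y (Or.inl hxy)
      omega
    have hsame : ∀ i (a b : Fin (u.letters.get i + 1)), a < b →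
        (f ⟨i, a⟩).1 = (f ⟨i, b⟩).1 ∧ (f ⟨i, a⟩).2.val < (f ⟨i, b⟩).2.val := by
      intro i a b hab
      have h1 := hf₁ ⟨i, a⟩ ⟨i, b⟩ (Or.inr ⟨rfl, hab⟩)
      have h2 := hf₂ ⟨i, b⟩ ⟨i, a⟩ (Or.inr ⟨rfl, hab⟩)
      omega
    have hfst : ∀ i (a : Fin (u.letters.get i + 1)), (f ⟨i, a⟩).1 = (f ⟨i, 0⟩).1 := by
      intro i a
      rcases (Fin.zero_le a).eq_or_lt with rfl | h
      · rfl
      · exact (hsame i 0 a h).1.symm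
    refine ⟨fun i => (f ⟨i, 0⟩).1, fun i j hij => hlt _ _ hij, fun i => ?_⟩
    have hmono : StrictMono fun a : Fin (u.letters.get i + 1) =>
        (⟨(f ⟨i, a⟩).2.val, by rw [← hfst i a]; exact (f ⟨i, a⟩).2.isLt⟩ :
          Fin (w.letters.get (f ⟨i, 0⟩).1 + 1)) :=
      fun a b hab => (hsame i a b hab).2
    simpa using Fintype.card_le_of_injective _ hmono.injective
  · rintro ⟨g, hg, h⟩
    refine he.le he' (fun x => ⟨g x.1, Fin.castLE (Nat.succ_le_succ (h x.1)) x.2⟩) ?_ ?_ <;>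
    · intro x y
      simp only [LayerPoint.posKey_lt_iff, LayerPoint.valKey_lt_iff, hg.lt_iff_lt,
        hg.injective.eq_iff, Fin.val_castLE]
      exact id

/-- A permutation is some `layeredPerm w` if its positions can be assigned layers, weakly increasing
from left to right, such that letters in the same layer decrease and letters in different
layers increase. -/
theorem exists_layeredPerm_eq {π : Permutation} {ℓ : Fin π.length → ℕ} (hmono : Monotone ℓ)
    (hℓ : ∀ i j, i < j → (π.toPerm i < π.toPerm j ↔ ℓ i < ℓ j)) : ∃ w, layeredPerm w = π := by
  classical
  set S := Finset.univ.image ℓ with hS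
  set s := S.orderEmbOfFin rfl with hs
  have hsmem : ∀ i, s i ∈ S := fun i => S.orderEmbOfFin_mem rfl i
  let fib : Fin S.card → Finset (Fin π.length) := fun i => Finset.univ.filter fun k => ℓ k = s i
  have hfib : ∀ i, 0 < (fib i).card := by
    intro i
    obtain ⟨k, -, hk⟩ := Finset.mem_image.1 (hsmem i)
    exact Finset.card_pos.2 ⟨k, by simp [fib, hk]⟩
  let w : Word ℕ := ⟨List.ofFn fun i => (fib i).card - 1⟩
  have hwl : w.letters.length = S.card := by simp [w]
  have hw : ∀ i, w.letters.get i + 1 = (fib (Fin.cast hwl i)).card := by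
    intro i
    have := hfib (Fin.cast hwl i)
    simp only [w, List.get_ofFn]
    simp only [Fin.cast] at this ⊢
    omega
  let F : LayerPoint w → Fin π.length := fun x =>
    (fib (Fin.cast hwl x.1)).orderEmbOfFin (hw x.1).symm x.2
  have hF : ∀ x, ℓ (F x) = s (Fin.cast hwl x.1) := by
    intro x
    have := (fib (Fin.cast hwl x.1)).orderEmbOfFin_mem (hw x.1).symm x.2
    exact (Finset.mem_filter.1 this).2
  have hlt : ∀ x y : LayerPoint w, x.1 < y.1 → F x < F y ∧ π.toPerm (F x) < π.toPerm (F y) := by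
    intro x y hxy
    have h1 : ℓ (F x) < ℓ (F y) := by
      rw [hF, hF]
      exact s.strictMono hxy
    have h2 := hmono.reflect_lt h1
    exact ⟨h2, (hℓ _ _ h2).2 h1⟩
  have hsame : ∀ x y : LayerPoint w, x.1 = y.1 → x.2.val < y.2.val →
      F x < F y ∧ π.toPerm (F y) < π.toPerm (F x) := by
    rintro ⟨i, a⟩ ⟨j, b⟩ hij hab
    obtain rfl : i = j := hij
    have h1 : F ⟨i, a⟩ < F ⟨i, b⟩ := (Finset.orderEmbOfFin _ _).strictMono hab
    refine ⟨h1, ?_⟩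
    refine lt_of_le_of_ne (not_lt.1 fun h => ?_) (fun h => h1.ne (π.toPerm.injective h).symm)
    have := (hℓ _ _ h1).1 h
    rw [hF, hF] at this
    exact lt_irrefl _ this
  obtain ⟨e, he⟩ := layeredPerm_spec w
  refine ⟨w, Permutation.eq_of_le_of_length_eq (he.le π.isRealizedBy_self F ?_ ?_) ?_⟩
  · intro x y h
    rcases LayerPoint.posKey_lt_iff.1 h with h | ⟨h, h'⟩
    exacts [(hlt x y h).1, (hsame x y h h').1]
  · intro x y h
    rcases LayerPoint.valKey_lt_iff.1 h with h | ⟨h, h'⟩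
    exacts [(hlt x y h).2, (hsame y x h.symm h').2]
  · have h1 : (layeredPerm w).length = Fintype.card (LayerPoint w) := by
      simpa using Fintype.card_congr e
    rw [h1, Fintype.card_sigma]
    simp only [Fintype.card_fin, hw]
    refine (Fintype.sum_equiv (finCongr hwl) _ (fun i => (fib i).card) (fun i => rfl)).trans ?_
    have h2 : (Finset.univ : Finset (Fin π.length)).card = ∑ b ∈ S, _ :=
      Finset.card_eq_sum_card_image ℓ Finset.univ
    rw [Finset.card_univ, Fintype.card_fin] at h2
    refine Eq.trans ?_ h2.symm
    rw [← Finset.sum_coe_sort S]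
    exact Fintype.sum_equiv (S.orderIsoOfFin rfl).toEquiv _ _ (fun i => rfl)

theorem Permutation.IsCut.le_of_le {π : Permutation} {m : ℕ} (h : π.IsCut m) {j : Fin π.length}
    (hj : m ≤ j) : m ≤ π.toPerm j := by
  by_contra! hlt
  let S : Finset (Fin π.length) := Finset.univ.filter fun i => (i : ℕ) < m
  have hsurj : Set.SurjOn π.toPerm S S := by
    refine Finset.surjOn_of_injOn_of_card_le _ (fun i hi => ?_) π.toPerm.injective.injOn le_rfl
    simp only [S, Finset.coe_filter, Finset.mem_univ, true_and] at hi ⊢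
    exact h i hi
  obtain ⟨i, hi, he⟩ := hsurj (a := π.toPerm j) (by simpa [S] using hlt)
  obtain rfl := π.toPerm.injective he
  simp [S] at hi
  omega

/-- The layer of a position of a layered permutation can be taken to be the number of
decompositions as a direct sum whose first summand ends to the left of this position. -/
theorem Permutation.IsLayered.exists_layers {π : Permutation} (h : π.IsLayered) :
    ∃ ℓ : Fin π.length → ℕ, Monotone ℓ ∧ ∀ i j, i < j → (π.toPerm i < π.toPerm j ↔ ℓ i < ℓ j) := by
  classical
  let cuts : Fin π.length → Finset ℕ := fun i => (Finset.range (i + 1)).filter π.IsCut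
  have hsub : ∀ i j, i ≤ j → cuts i ⊆ cuts j := by
    intro i j hij m hm
    simp only [cuts, Finset.mem_filter, Finset.mem_range] at hm ⊢
    exact ⟨by have : (i : ℕ) ≤ j := hij; omega, hm.2⟩
  refine ⟨fun i => (cuts i).card, fun i j hij => Finset.card_le_card (hsub i j hij), ?_⟩
  intro i j hij
  by_cases hs : π.SameComponent i j
  · have heq : cuts i = cuts j := by
      refine (hsub i j hij.le).antisymm fun m hm => ?_
      simp only [cuts, Finset.mem_filter, Finset.mem_range] at hm ⊢
      refine ⟨?_, hm.2⟩
      by_contra! hlt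
      exact hs ⟨m, hm.2, by omega, by omega⟩
    simp only [heq, lt_irrefl, iff_false, not_lt]
    exact (h i j hij hs).le
  · obtain ⟨m, hm, him, hmj⟩ := not_not.1 hs
    refine iff_of_true ?_ ?_
    · have h1 := hm i him
      have h2 := hm.le_of_le hmj
      exact Fin.lt_def.2 (by omega)
    · refine Finset.card_lt_card ⟨hsub i j hij.le, fun hss => ?_⟩
      have hmem : m ∈ cuts j := by
        simp only [cuts, Finset.mem_filter, Finset.mem_range]
        exact ⟨by omega, hm⟩
      have := hss hmem
      simp only [cuts, Finset.mem_filter, Finset.mem_range] at this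
      omega

theorem Permutation.IsLayered.exists_layeredPerm_eq_of_le {σ τ : Permutation} (hτ : τ.IsLayered)
    (h : σ ≤ τ) : ∃ w, layeredPerm w = σ := by
  obtain ⟨ℓ, h1, h2⟩ := hτ.exists_layers
  obtain ⟨f, hf⟩ := h
  exact exists_layeredPerm_eq (ℓ := ℓ ∘ f) (h1.comp f.monotone)
    fun i j hij => (hf i j).trans (h2 _ _ (f.strictMono hij))

theorem isRootedForest_nat : IsRootedForest ℕ :=
  fun x => ⟨Set.finite_Iic x, fun a _ b _ _ => le_total a b⟩

theorem isShellableInterval_of_isLayered {σ τ : Permutation} (hτ : τ.IsLayered) (hle : σ ≤ τ)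
    (h : ¬ HasNontrivialDisconnectedSubinterval σ τ) : IsShellableInterval σ τ := by
  let φ : Word ℕ ↪o Permutation := OrderEmbedding.ofMapLEIff layeredPerm fun _ _ => layeredPerm_le_iff
  have hrange : Set.Iic τ ⊆ Set.range φ := fun π hπ => hτ.exists_layeredPerm_eq_of_le hπ
  obtain ⟨u, rfl⟩ := hrange hle
  obtain ⟨w, rfl⟩ := hrange (Set.mem_Iic.2 le_rfl)
  refine IsShellableInterval.map φ hrange ?_
  exact (dualCL_of_not_hasNontrivialDisconnectedSubinterval isRootedForest_nat
    (φ.le_iff_le.1 hle) fun h' => h (h'.map φ hrange)).2.2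

end Layered

end SubwordShelling

open SubwordShelling
theorem mainTheorem1 :
    (∀ (P : Type*) [PartialOrder P], IsRootedForest P →
      ∀ u w : Word P, u ≤ w → ¬ HasNontrivialDisconnectedSubinterval u w →
        IsDualCLLabeling u w (modifiedPositionLabeling w) ∧
        IsDualCLShellable u w ∧
        IsShellableInterval u w) ∧
    (∀ σ τ : Permutation, σ.IsLayered → τ.IsLayered → σ ≤ τ →
      ¬ HasNontrivialDisconnectedSubinterval σ τ →
        IsShellableInterval σ τ) := by
  exact ⟨fun _ _ hP _ _ huw h => dualCL_of_not_hasNontrivialDisconnectedSubinterval hP huw h,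
    fun _ _ _ hτ hle h => isShellableInterval_of_isLayered hτ hle h⟩
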